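/- Let $A$ be a Dedekind domain such that for every nonzero prime ideal $\mathfrak p$ of $A$ the local ring $A_{\mathfrak p}$ has mixed characteristic (that is, $A_{\mathfrak p}$ has characteristic zero and its residue field has positive characteristic) and finite residue field. Let $R=A[X_1,\dots,X_n]$ be $\mathbb Z^n$-graded by $\deg a=0$ for $a\in A$ and $\deg X_j=e_j$, and let $I=(a_1U_1,\dots,a_cU_c)\subseteq R$ with $a_j\in A$ (not necessarily units) and $U_j$ monomials in $X_1,\dots,X_n$ (a $\mathfrak C$-monomial ideal). Let $i\ge 0$ and let $M=H^i_I(R)=\bigoplus_{u\in\mathbb Z^n}M_u$ be the local cohomology module with its natural $\mathbb Z^n$-grading, i.e. the $i$-th cohomology of the Čech complex of $R$ on the homogeneous elements $a_1U_1,\dots,a_cU_c$. For an ideal $J$ of a commutative ring $B$ and a $B$-module $L$ put $\Gamma_J(L)=\bigcup_{m\ge 1}(0:_L J^m)$. Fix $u\in\mathbb Z^n$. (1) For every nonzero $\mathfrak p\in\operatorname{Ass}_A M$ there are integers $\ell,t\ge 0$ and $\beta_1,\dots,\beta_t\ge 0$ (depending on $\mathfrak p$ and $u$) and an isomorphism of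 $A$-modules $$\Gamma_{\mathfrak p}(M_u)\;\cong\;E_A(A/\mathfrak p)^{\ell}\oplus\bigoplus_{j=1}^{t}A/\mathfrak p^{\beta_j},$$ where $E_A(A/\mathfrak p)$ is the injective hull of $A/\mathfrak p$ over $A$. (2) Let $\mathfrak q$ be a nonzero prime ideal of $A$, let $T=\widehat{A_{\mathfrak q}}$ be the completion of $A_{\mathfrak q}$ with respect to its maximal ideal, let $K_{\mathfrak q}$ be the fraction field of $T$, let $S=T[X_1,\dots,X_n]$, and let $N=M\otimes_A T$, with $N_u=M_u\otimes_A T$. Then $N_u\cong H^i_{IS}(S)_u$ as $T$-modules, and there are integers $a,b\ge 0$ (depending on $\mathfrak q$ and $u$) and an isomorphism of $T$-modules $$N_u/\Gamma_{\mathfrak q T}(N_u)\;\cong\;T^{a}\oplus K_{\mathfrak q}^{b}.$$ -/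

import Mathlib

open scoped TensorProduct

/-! ### Torsion with respect to an ideal -/

/-- `Γ_J(N) = ⋃ₘ (0 :_N Jᵐ)`, the `J`-torsion submodule of `N`. -/
def gammaTorsion {A : Type*} [CommRing A] (J : Ideal A) (N : Type*) [AddCommGroup N]
    [Module A N] : Submodule A N where
  carrier := {x | ∃ m : ℕ, ∀ r ∈ J ^ m, r • x = 0}
  zero_mem' := ⟨0, fun r _ => smul_zero r⟩
  add_mem' := by
    rintro x y ⟨m, hm⟩ ⟨k, hk⟩
    refine ⟨m + k, fun r hr => ?_⟩
    rw [smul_add, hm r (Ideal.pow_le_pow_right (Nat.le_add_right m k) hr),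
      hk r (Ideal.pow_le_pow_right (Nat.le_add_left k m) hr), add_zero]
  smul_mem' := by
    rintro c x ⟨m, hm⟩
    exact ⟨m, fun r hr => by rw [smul_comm, hm r hr, smul_zero]⟩

/-! ### Injective hulls -/

/-- `ι : N → E` is an injective hull of `N`: `E` is an injective module, `ι` is injective, and
every nonzero submodule of `E` meets the image of `ι` nontrivially. -/
structure IsInjectiveHull {A : Type*} [CommRing A] {N : Type*} [AddCommGroup N] [Module A N]
    {E : Type*} [AddCommGroup E] [Module A E] (ι : N →ₗ[A] E) : Prop where
  moduleInjective : Module.Injective A E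
  injective : Function.Injective ι
  essential : ∀ W : Submodule A E, W ⊓ LinearMap.range ι = ⊥ → W = ⊥

/-- Every module has an injective hull. -/
theorem exists_isInjectiveHull.{u} (A : Type u) [CommRing A] (N : Type u) [AddCommGroup N]
    [Module A N] :
    ∃ (E : ModuleCat.{u} A) (ι : N →ₗ[A] E), IsInjectiveHull ι := by
  have : CategoryTheory.EnoughInjectives (ModuleCat.{u} A) := inferInstance
  obtain ⟨⟨J, hJ, f, hf⟩⟩ := this.presentation (ModuleCat.of A N)
  have hQ : Module.Injective A J := (Module.injective_iff_injective_object A J).2 hJ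
  have hfi : Function.Injective f.hom := (ModuleCat.mono_iff_injective f).1 hf
  -- `E` is a maximal essential extension of the image of `N` in an injective module `J`.
  obtain ⟨E, hNE, ⟨-, hE⟩, hmax⟩ := zorn_le_nonempty₀
    {W : Submodule A J | LinearMap.range f.hom ≤ W ∧
      ∀ V ≤ W, V ⊓ LinearMap.range f.hom = ⊥ → V = ⊥}
    (by
      intro K hK hchain y hy
      refine ⟨sSup K, ⟨(hK hy).1.trans (le_sSup hy), fun V hV hVN => ?_⟩, fun z => le_sSup⟩
      rw [eq_bot_iff]
      intro x hx
      obtain ⟨W, hW, hxW⟩ :=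
        (Submodule.mem_sSup_of_directed ⟨y, hy⟩ hchain.directedOn).1 (hV hx)
      have h0 : V ⊓ W = ⊥ := (hK hW).2 _ inf_le_right
        (eq_bot_iff.2 ((inf_le_inf_right _ inf_le_left).trans hVN.le))
      exact h0.le ⟨hx, hxW⟩)
    (LinearMap.range f.hom)
    ⟨le_rfl, fun V hV h => by rwa [inf_eq_left.2 hV] at h⟩
  obtain ⟨C, -, hC, hCmax⟩ := zorn_le_nonempty₀ {W : Submodule A J | W ⊓ E = ⊥}
    (by
      intro K hK hchain y hy
      refine ⟨sSup K, ?_, fun z => le_sSup⟩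
      rw [Set.mem_ofPred_eq, eq_bot_iff]
      rintro x ⟨hx, hxE⟩
      obtain ⟨W, hW, hxW⟩ := (Submodule.mem_sSup_of_directed ⟨y, hy⟩ hchain.directedOn).1 hx
      exact (show W ⊓ E = ⊥ from hK hW).le ⟨hxW, hxE⟩)
    ⊥ (by simp)
  have hC0 : C ⊓ E = ⊥ := hC
  have hginj : Function.Injective (C.mkQ ∘ₗ E.subtype) := by
    rw [← LinearMap.ker_eq_bot, eq_bot_iff]
    intro x hx
    have hxC : (x : J) ∈ C := by simpa using hx
    exact Subtype.ext (hC0.le ⟨hxC, x.2⟩)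
  obtain ⟨h, hh⟩ := hQ.out (C.mkQ ∘ₗ E.subtype) hginj E.subtype
  have hh' : ∀ x ∈ E, h (C.mkQ x) = x := fun x hx => hh ⟨x, hx⟩
  have hkey : ∀ V : Submodule A J, V ⊓ E = ⊥ → ∀ y, h y ∈ V → y = 0 := by
    intro V hV y hy
    obtain ⟨x, rfl⟩ := C.mkQ_surjective y
    have hle : C ≤ (V.comap h).comap C.mkQ := fun z hz => by
      have : C.mkQ z = 0 := by simpa using hz
      simp [Submodule.mem_comap, this]
    have hD : (V.comap h).comap C.mkQ ∈ {W : Submodule A J | W ⊓ E = ⊥} := by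
      rw [Set.mem_ofPred_eq, eq_bot_iff]
      rintro z ⟨hz, hzE⟩
      have hz' : h (C.mkQ z) ∈ V := hz
      rw [hh' z hzE] at hz'
      exact hV.le ⟨hz', hzE⟩
    have hx : x ∈ C := hCmax hD hle hy
    simpa using hx
  have hrange : LinearMap.range h ≤ E := by
    have hEr : E ≤ LinearMap.range h := fun x hx => ⟨_, hh' x hx⟩
    refine hmax ⟨hNE.trans hEr, fun V hV hVN => ?_⟩ hEr
    have hVE : V ⊓ E = ⊥ := hE _ inf_le_right
      (eq_bot_iff.2 ((inf_le_inf_right _ inf_le_left).trans hVN.le))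
    rw [eq_bot_iff]
    intro x hx
    obtain ⟨y, rfl⟩ := hV hx
    simp [hkey V hVE y hx]
  let r : J →ₗ[A] E := (h ∘ₗ C.mkQ).codRestrict E fun x => hrange ⟨_, rfl⟩
  refine ⟨ModuleCat.of A E, f.hom.codRestrict E fun x => hNE ⟨x, rfl⟩, ⟨?_, ?_, ?_⟩⟩
  · refine ⟨fun X Y _ _ _ _ k hk g => ?_⟩
    obtain ⟨g', hg'⟩ := hQ.out k hk (E.subtype ∘ₗ g)
    refine ⟨r ∘ₗ g', fun x => Subtype.ext ?_⟩
    change h (C.mkQ (g' (k x))) = _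
    rw [hg' x]
    exact hh' _ (g x).2
  · intro x y hxy
    exact hfi (congrArg Subtype.val hxy)
  · intro W hW
    have h0 : W.map E.subtype = ⊥ := by
      refine hE _ (Submodule.map_subtype_le _ _) (eq_bot_iff.2 ?_)
      rintro _ ⟨⟨x, hx, rfl⟩, ⟨y, hy⟩⟩
      have : x = 0 := hW.le ⟨hx, ⟨y, Subtype.ext hy⟩⟩
      simp [this]
    rw [eq_bot_iff]
    intro x hx
    have hx0 : (x : J) ∈ W.map E.subtype := ⟨x, hx, rfl⟩
    rw [h0] at hx0
    exact Subtype.ext hx0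

/-- The injective hull `E_A(N)` of an `A`-module `N` (unique up to isomorphism). -/
noncomputable def InjectiveHull.{u} (A : Type u) [CommRing A] (N : Type u) [AddCommGroup N]
    [Module A N] : ModuleCat.{u} A :=
  (exists_isInjectiveHull A N).choose

/-! ### Local cohomology of a ring, as the cohomology of the Čech complex -/

section Cech

variable {R : Type*} [CommRing R] {c : ℕ}

/-- The localization map `R_x → R_y` when `x` divides `y`. -/
noncomputable def awayMap {x y : R} (h : x ∣ y) :
    Localization.Away x →ₐ[R] Localization.Away y :=
  IsLocalization.liftAlgHom (M := Submonoid.powers x)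
    (f := Algebra.ofId R (Localization.Away y)) (by
      rintro ⟨_, m, rfl⟩
      have hy : IsUnit (algebraMap R (Localization.Away y) y) :=
        IsLocalization.Away.algebraMap_isUnit y
      simpa [Algebra.ofId_apply] using
        (isUnit_of_dvd_unit (map_dvd (algebraMap R (Localization.Away y)) h) hy).pow m)

/-- `Čᵏ(f; R) = ⨁_{|S| = k} R_{f_S}` with `f_S = ∏_{j ∈ S} f_j`. -/
abbrev CechCochain (f : Fin c → R) (k : ℕ) : Type _ :=
  ∀ S : {S : Finset (Fin c) // S.card = k}, Localization.Away (∏ j ∈ S.1, f j)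

/-- The Čech differential: if `S = {j₀ < ⋯ < j_k}`, then `(dx)_S = ∑ₛ (-1)ˢ x_{S ∖ {jₛ}}`,
the terms being mapped to `R_{f_S}`. -/
noncomputable def cechD (f : Fin c → R) (k : ℕ) :
    CechCochain f k →ₗ[R] CechCochain f (k + 1) :=
  LinearMap.pi fun S => ∑ j : S.1,
    (-1 : R) ^ (S.1.filter (· < j.1)).card •
      ((awayMap (Finset.prod_dvd_prod_of_subset _ _ f (Finset.erase_subset j.1 S.1))).toLinearMap
        ∘ₗ LinearMap.proj
          (⟨S.1.erase j.1, by rw [Finset.card_erase_of_mem j.2, S.2]; rfl⟩ :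
            {S : Finset (Fin c) // S.card = k}))

/-- The cocycles of the Čech complex. -/
noncomputable abbrev cechCocycles (f : Fin c → R) (i : ℕ) : Submodule R (CechCochain f i) :=
  LinearMap.ker (cechD f i)

/-- The coboundaries of the Čech complex. -/
noncomputable def cechCoboundaries (f : Fin c → R) :
    (i : ℕ) → Submodule R (CechCochain f i)
  | 0 => ⊥
  | i + 1 => LinearMap.range (cechD f i)

/-- The local cohomology module `H^i_I(R)` for `I = (f₁, …, f_c)`: the `i`-th cohomology of the
Čech complex `0 → R → ⨁ R_{f_j} → ⨁ R_{f_j f_k} → ⋯ → R_{f₁⋯f_c} → 0`. -/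
abbrev LocalCohomologyModule (f : Fin c → R) (i : ℕ) : Type _ :=
  cechCocycles f i ⧸ (cechCoboundaries f i).submoduleOf (cechCocycles f i)

end Cech

/-! ### The multigrading for `ℭ`-monomial ideals -/

section Grading

variable {A : Type*} [CommRing A] {n c : ℕ}

/-- The generators `a_j X^{ξ_j}` of a `ℭ`-monomial ideal in `A[X₁, …, X_n]`. -/
noncomputable abbrev cMonomial (a : Fin c → A) (ξ : Fin c → Fin n →₀ ℕ) :
    Fin c → MvPolynomial (Fin n) A :=
  fun j => MvPolynomial.monomial (ξ j) (a j)

/-- For `f ∈ A[X₁, …, X_n]` homogeneous of multidegree `e`, the degree `u` component of the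
localization `A[X₁, …, X_n]_f`: it is spanned by the fractions `b X^d / f^m` with `d - m e = u`. -/
noncomputable def awayDegree (f : MvPolynomial (Fin n) A) (e : Fin n →₀ ℕ) (u : Fin n → ℤ) :
    Submodule A (Localization.Away f) :=
  Submodule.span A {x | ∃ (m : ℕ) (d : Fin n →₀ ℕ) (b : A),
    (∀ k, (d k : ℤ) - m * e k = u k) ∧
      x * algebraMap (MvPolynomial (Fin n) A) (Localization.Away f) (f ^ m) =
        algebraMap (MvPolynomial (Fin n) A) (Localization.Away f) (MvPolynomial.monomial d b)}

/-- The degree `u` component of the Čech complex on the generators `a_j X^{ξ_j}`. -/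
noncomputable def cechDegree (a : Fin c → A) (ξ : Fin c → Fin n →₀ ℕ) (k : ℕ) (u : Fin n → ℤ) :
    Submodule A (CechCochain (cMonomial a ξ) k) :=
  Submodule.pi Set.univ fun S => awayDegree (∏ j ∈ S.1, cMonomial a ξ j) (∑ j ∈ S.1, ξ j) u

/-- The degree `u` component of `H^i_I(A[X₁, …, X_n])`, where `I` is generated by the
`a_j X^{ξ_j}`: the classes of the cocycles of degree `u`. -/
noncomputable def localCohomologyDegree (a : Fin c → A) (ξ : Fin c → Fin n →₀ ℕ) (i : ℕ)
    (u : Fin n → ℤ) : Submodule A (LocalCohomologyModule (cMonomial a ξ) i) :=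
  ((cechDegree a ξ i u).comap ((cechCocycles (cMonomial a ξ) i).subtype.restrictScalars A)).map
    (((cechCoboundaries (cMonomial a ξ) i).submoduleOf
      (cechCocycles (cMonomial a ξ) i)).mkQ.restrictScalars A)

end Grading

/-! ### Rings -/

/-- A local ring has mixed characteristic: it has characteristic zero and its residue field has
positive characteristic. -/
def IsMixedChar (B : Type*) [CommRing B] [IsLocalRing B] : Prop :=
  CharZero B ∧ ringChar (IsLocalRing.ResidueField B) ≠ 0

/-- The completion of the local ring `A_𝔮` with respect to its maximal ideal. -/
abbrev CompletedLocalization {A : Type*} [CommRing A] (q : Ideal A) [q.IsPrime] : Type _ :=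
  AdicCompletion (IsLocalRing.maximalIdeal (Localization.AtPrime q)) (Localization.AtPrime q)

/-!
In degree `u`, the localization of `A[X₁, …, X_n]` at `∏_{j ∈ S} a_j X^{ξ_j}` is `A_{a_S} Xᵘ`, where
`a_S = ∏_{j ∈ S} a_j`, if every variable with a negative exponent in `u` divides some `X^{ξ_j}` with
`j ∈ S`, and zero otherwise. So `H^i_I(R)_u` is the cohomology of a finite complex of products of
localizations `A_{a_S}`, the `S` running over the index sets allowed by `u`; this complex commutes
with base change, and its cohomology with flat base change.

Over a discrete valuation ring `B` with fraction field `K`, each localization of `B` at an element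
is `B`, `K` or `0`. The image in the cohomology of the `K`-vector space part of the cochains is
divisible, hence a direct summand; as a quotient of a `K`-vector space by a finitely generated
submodule it is `(K/B)ˡ ⊕ Kˢ`, and the complement is a finite module. Both claims follow from this
decomposition: it is applied over the completion of `A_𝔮`, and over `A_𝔭`, where `Γ_𝔭` does not
change under localization and `K/A_𝔭` is the injective hull of `A/𝔭`.
-/

/-! ### Homology and flat base change -/

section Homology

/-- The homology `ker g / im f` at `Y` of a pair of maps `X → Y → Z`. The composite is not required
to vanish: only the part of `im f` lying in `ker g` is divided out. -/
abbrev LinearHomology {R X Y Z : Type*} [CommRing R] [AddCommGroup X] [Module R X]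
    [AddCommGroup Y] [Module R Y] [AddCommGroup Z] [Module R Z]
    (f : X →ₗ[R] Y) (g : Y →ₗ[R] Z) : Type _ :=
  LinearMap.ker g ⧸ (LinearMap.range f).submoduleOf (LinearMap.ker g)

theorem nonempty_linearEquiv_of_surjective_of_ker_eq {R M P Q : Type*} [Ring R]
    [AddCommGroup M] [Module R M] [AddCommGroup P] [Module R P] [AddCommGroup Q] [Module R Q]
    (f : M →ₗ[R] P) (g : M →ₗ[R] Q) (hf : Function.Surjective f) (hg : Function.Surjective g)
    (h : LinearMap.ker f = LinearMap.ker g) : Nonempty (P ≃ₗ[R] Q) :=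
  ⟨(f.quotKerEquivOfSurjective hf).symm ≪≫ₗ Submodule.quotEquivOfEq _ _ h ≪≫ₗ
    g.quotKerEquivOfSurjective hg⟩

variable {R S X Y Z X' Y' Z' : Type*} [CommRing R] [CommRing S] [Algebra R S] [Module.Flat R S]
  [AddCommGroup X] [Module R X] [AddCommGroup Y] [Module R Y] [AddCommGroup Z] [Module R Z]
  [AddCommGroup X'] [Module R X'] [Module S X'] [IsScalarTower R S X']
  [AddCommGroup Y'] [Module R Y'] [Module S Y'] [IsScalarTower R S Y']
  [AddCommGroup Z'] [Module R Z'] [Module S Z'] [IsScalarTower R S Z']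
  {f : X →ₗ[R] Y} {g : Y →ₗ[R] Z} {f' : X' →ₗ[S] Y'} {g' : Y' →ₗ[S] Z'}
  {tX : X →ₗ[R] X'} {tY : Y →ₗ[R] Y'} {tZ : Z →ₗ[R] Z'}

theorem exists_isBaseChange_ker (hY : IsBaseChange S tY) (hZ : IsBaseChange S tZ)
    (hg : ∀ y, g' (tY y) = tZ (g y)) :
    ∃ t : LinearMap.ker g →ₗ[R] LinearMap.ker g', (∀ y, (t y : Y') = tY y) ∧ IsBaseChange S t := by
  let t : LinearMap.ker g →ₗ[R] LinearMap.ker g' :=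
    { toFun y := ⟨tY y, by simp [hg]⟩
      map_add' y z := Subtype.ext (map_add tY _ _)
      map_smul' r y := Subtype.ext (map_smul tY r _) }
  exact ⟨t, fun _ => rfl, .of_left_exact S t tY tZ (g := g) (g' := g')
    (f' := (LinearMap.ker g').subtype) rfl (LinearMap.ext fun y => (hg y).symm) hY hZ
    g.exact_subtype_ker_map (Submodule.injective_subtype _)
    g'.exact_subtype_ker_map (Submodule.injective_subtype _)⟩

/-- The map `ker (g ∘ f) → ker g` induced by `f`, whose cokernel is `LinearHomology f g`. -/
def kerCompMap (f : X →ₗ[R] Y) (g : Y →ₗ[R] Z) : LinearMap.ker (g ∘ₗ f) →ₗ[R] LinearMap.ker g :=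
  f.restrict fun _ => id

theorem coe_kerCompMap (f : X →ₗ[R] Y) (g : Y →ₗ[R] Z) (x : LinearMap.ker (g ∘ₗ f)) :
    (kerCompMap f g x : Y) = f x :=
  rfl

theorem exact_kerCompMap_mkQ (f : X →ₗ[R] Y) (g : Y →ₗ[R] Z) :
    Function.Exact (kerCompMap f g) ((LinearMap.range f).submoduleOf (LinearMap.ker g)).mkQ := by
  refine LinearMap.exact_iff.2 (Submodule.ext fun y => ?_)
  rw [Submodule.ker_mkQ]
  constructor
  · rintro ⟨x, hx⟩
    exact ⟨⟨x, by simp [hx]⟩, Subtype.ext hx⟩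
  · rintro ⟨x, rfl⟩
    exact ⟨x, rfl⟩

theorem nonempty_linearHomology_baseChange_equiv (hX : IsBaseChange S tX) (hY : IsBaseChange S tY)
    (hZ : IsBaseChange S tZ) (hf : ∀ x, f' (tX x) = tY (f x)) (hg : ∀ y, g' (tY y) = tZ (g y)) :
    Nonempty (S ⊗[R] LinearHomology f g ≃ₗ[S] LinearHomology f' g') := by
  obtain ⟨s, hs, hs'⟩ := exists_isBaseChange_ker (g := g ∘ₗ f) (g' := g' ∘ₗ f') hX hZ
    (by simp [hf, hg])
  obtain ⟨t, ht, ht'⟩ := exists_isBaseChange_ker hY hZ hg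
  have hst : ∀ x, t (kerCompMap f g x) = kerCompMap f' g' (s x) := fun x =>
    Subtype.ext (by rw [ht, coe_kerCompMap, coe_kerCompMap, hs, hf])
  let p := ((LinearMap.range f').submoduleOf (LinearMap.ker g')).mkQ
  let h : LinearHomology f g →ₗ[R] LinearHomology f' g' :=
    Submodule.liftQ _ (p.restrictScalars R ∘ₗ t) (by
      rintro y hy
      obtain ⟨x, rfl⟩ := (exact_kerCompMap_mkQ f g y).1 (by simpa using hy)
      rw [LinearMap.mem_ker, LinearMap.comp_apply, hst]
      exact (exact_kerCompMap_mkQ f' g').apply_apply_eq_zero _)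
  exact ⟨(IsBaseChange.of_right_exact S s t h (LinearMap.ext hst) (LinearMap.ext fun _ => rfl)
    hs' ht' (exact_kerCompMap_mkQ f g) (Submodule.mkQ_surjective _)
    (exact_kerCompMap_mkQ f' g') (Submodule.mkQ_surjective _)).equiv⟩

end Homology

/-! ### Finite modules up to vector spaces over the fraction field -/

section VectorSpaceByFinite

theorem baer_of_forall_exists_smul_eq {B Q : Type*} [CommRing B]
    [IsPrincipalIdealRing B] [AddCommGroup Q] [Module B Q]
    (h : ∀ b : B, b ≠ 0 → ∀ x : Q, ∃ y, b • y = x) : Module.Baer B Q := by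
  intro I g
  obtain ⟨b, rfl⟩ := IsPrincipalIdealRing.principal I
  obtain rfl | hb := eq_or_ne b 0
  · refine ⟨0, fun x hx => ?_⟩
    obtain rfl : x = 0 := by simpa using hx
    exact (map_zero g).symm
  · obtain ⟨y, hy⟩ := h b hb (g ⟨b, Submodule.mem_span_singleton_self b⟩)
    refine ⟨LinearMap.toSpanSingleton B Q y, fun x hx => ?_⟩
    obtain ⟨c, rfl⟩ := Submodule.mem_span_singleton.1 hx
    rw [LinearMap.toSpanSingleton_apply, smul_assoc, hy, ← map_smul]
    rfl

theorem finite_of_surjective_of_ker_le {B M F Q : Type*} [CommRing B] [AddCommGroup M] [Module B M]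
    [AddCommGroup F] [Module B F] [IsNoetherian B F] [AddCommGroup Q] [Module B Q]
    (α : M →ₗ[B] F) (β : M →ₗ[B] Q) (hβ : Function.Surjective β)
    (h : LinearMap.ker α ≤ LinearMap.ker β) : Module.Finite B Q := by
  have : Module.Finite B (M ⧸ LinearMap.ker α) := .equiv α.quotKerEquivRange.symm
  refine .of_surjective ((LinearMap.ker α).liftQ β h) ?_
  rwa [← LinearMap.range_eq_top, Submodule.range_liftQ, LinearMap.range_eq_top]

variable {B : Type*} (K : Type*) [CommRing B] [Field K] [Algebra B K] [IsFractionRing B K]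

section VectorSpace

variable {V M : Type*} [AddCommGroup V] [Module K V] [Module B V] [IsScalarTower B K V]
  [AddCommGroup M] [Module B M]

include K in
theorem exists_smul_eq_of_isFractionRing {b : B} (hb : b ≠ 0) (v : V) : ∃ w, b • w = v :=
  ⟨(algebraMap B K b)⁻¹ • v, by
    rw [← algebraMap_smul K b, smul_inv_smul₀ (by simpa using hb)]⟩

/-- The kernel of a `B`-linear map from a vector space over the fraction field `K` of `B` to a
torsion-free `B`-module, as a `K`-subspace. -/
def kerSubspace [IsDomain B] [Module.IsTorsionFree B M] (φ : V →ₗ[B] M) : Submodule K V where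
  __ := LinearMap.ker φ
  smul_mem' k v hv := by
    obtain ⟨a, b, hb, rfl⟩ := IsFractionRing.div_surjective (A := B) k
    have hb0 : b ≠ 0 := nonZeroDivisors.ne_zero hb
    have hbK : algebraMap B K b ≠ 0 := by simpa using hb0
    have hv : φ v = 0 := hv
    change φ _ = 0
    rw [← smul_eq_zero_iff_right hb0, ← map_smul, ← algebraMap_smul K b, smul_smul,
      mul_div_cancel₀ _ hbK, algebraMap_smul, map_smul, hv, smul_zero]

include K in
theorem isTorsionFree_quotient_range [IsDomain B] [Module.IsTorsionFree B M] (φ : V →ₗ[B] M) :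
    Module.IsTorsionFree B (M ⧸ LinearMap.range φ) := by
  refine .of_smul_eq_zero fun b x hx => or_iff_not_imp_left.2 fun hb => ?_
  obtain ⟨y, rfl⟩ := Submodule.mkQ_surjective _ x
  rw [← map_smul, Submodule.mkQ_apply, Submodule.Quotient.mk_eq_zero] at hx
  obtain ⟨v, hv⟩ := hx
  obtain ⟨w, rfl⟩ := exists_smul_eq_of_isFractionRing K hb v
  rw [map_smul] at hv
  exact (Submodule.Quotient.mk_eq_zero _).2 ⟨w, smul_right_injective M hb hv⟩

theorem exists_basis_mem_iff_of_fg [IsDomain B] [IsPrincipalIdealRing B] [Module.Finite K V]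
    {N : Submodule B V} (hN : N.FG) :
    ∃ (l m : ℕ) (w : Module.Basis (Fin l ⊕ Fin m) K V),
      ∀ v, v ∈ N ↔ ∃ c : Fin l → B, w.equivFun v = Sum.elim (fun i => algebraMap B K (c i)) 0 := by
  have : Module.Finite B N := .of_fg hN
  have : Module.IsTorsionFree B V := .trans K
  obtain ⟨l, b⟩ := Module.basisOfFiniteTypeTorsionFree' (R := B) (M := N)
  have hb : LinearIndependent K fun i => (b i : V) :=
    (LinearIndependent.iff_fractionRing B K).1 (b.linearIndependent.map' _ N.ker_subtype)
  let w := Module.Basis.sumExtend hb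
  have hw : ∀ i, w (Sum.inl i) = b i := fun i => by simp [w, Module.Basis.sumExtend]; rfl
  have := Module.Finite.finite_basis w
  have : Finite (Module.Basis.sumExtendIndex hb) :=
    .of_injective _ (Sum.inr_injective (α := Fin l))
  let ε := (Equiv.refl (Fin l)).sumCongr (Finite.equivFin (Module.Basis.sumExtendIndex hb))
  have hwε : ∀ i, w.reindex ε (Sum.inl i) = b i := fun i => by
    rw [Module.Basis.reindex_apply, ← hw]
    rfl
  refine ⟨l, _, w.reindex ε, fun v => ?_⟩
  rw [b.mem_submodule_iff']
  refine exists_congr fun c => ?_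
  rw [← LinearEquiv.eq_symm_apply, Module.Basis.equivFun_symm_apply, Fintype.sum_sum_type]
  simp only [hwε, Sum.elim_inl, Sum.elim_inr, Pi.zero_apply, zero_smul, Finset.sum_const_zero,
    add_zero, algebraMap_smul]

/-- The `B`-module `K / B`, for `K` the fraction field of `B`. -/
abbrev FractionQuotient (B K : Type*) [CommRing B] [Field K] [Algebra B K] : Type _ :=
  K ⧸ LinearMap.range (Algebra.linearMap B K)

theorem exists_equiv_of_surjective_of_fg_ker [IsDomain B] [IsPrincipalIdealRing B]
    [Module.Finite K V] (φ : V →ₗ[B] M) (hφ : Function.Surjective φ) (hN : (LinearMap.ker φ).FG) :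
    ∃ l s : ℕ, Nonempty (M ≃ₗ[B] (Fin l → FractionQuotient B K) × (Fin s → K)) := by
  obtain ⟨l, s, w, hw⟩ := exists_basis_mem_iff_of_fg K hN
  let π : K →ₗ[B] FractionQuotient B K := Submodule.mkQ _
  have hπ : Function.Surjective π := Submodule.mkQ_surjective _
  have hπ0 : ∀ x, π x = 0 ↔ ∃ b, x = algebraMap B K b := fun x =>
    (Submodule.Quotient.mk_eq_zero _).trans (exists_congr fun _ => eq_comm)
  let ψ : V →ₗ[B] (Fin l → FractionQuotient B K) × (Fin s → K) :=
    (π.compLeft (Fin l) ∘ₗ LinearMap.funLeft B K Sum.inl).prod (LinearMap.funLeft B K Sum.inr) ∘ₗ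
      w.equivFun.toLinearMap.restrictScalars B
  have hψ_apply : ∀ v, ψ v =
      (fun i => π (w.equivFun v (.inl i)), fun j => w.equivFun v (.inr j)) := fun _ => rfl
  have hψ : Function.Surjective ψ := by
    rintro ⟨x, y⟩
    choose x' hx' using fun i => hπ (x i)
    refine ⟨w.equivFun.symm (Sum.elim x' y), ?_⟩
    rw [hψ_apply, LinearEquiv.apply_symm_apply]
    exact Prod.ext (funext hx') rfl
  have hker : LinearMap.ker φ = LinearMap.ker ψ := by
    ext v
    rw [hw, LinearMap.mem_ker, hψ_apply, Prod.mk_eq_zero]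
    simp only [hπ0, funext_iff, Sum.forall, Classical.skolem, Sum.elim_inl, Sum.elim_inr,
      Pi.zero_apply, exists_and_right]
  obtain ⟨e⟩ := nonempty_linearEquiv_of_surjective_of_ker_eq φ ψ hφ hψ hker
  exact ⟨l, s, ⟨e⟩⟩

end VectorSpace

variable (B) in
/-- `Y` is an extension of a finite `B`-module by the image of a finite-dimensional vector space
over the fraction field `K` of `B`. -/
def IsFiniteModVectorSpace (Y : Type*) [AddCommGroup Y] [Module B Y] : Prop :=
  ∃ (m : ℕ) (p : (Fin m → K) →ₗ[B] Y), Module.Finite B (Y ⧸ LinearMap.range p)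

variable (B) in
/-- `H ≅ (K/B)ˡ ⊕ ⨁ⱼ B/𝔪^βⱼ ⊕ Bʳ ⊕ Kˢ`, where `K` is the fraction field of the local ring `B` with
maximal ideal `𝔪`; the torsion summands are grouped together. -/
def HasTorsionSplitting (H : Type*) [IsLocalRing B] [AddCommGroup H] [Module B H] : Prop :=
  ∃ (l t : ℕ) (β : Fin t → ℕ) (r s : ℕ), Nonempty (H ≃ₗ[B]
    ((Fin l → FractionQuotient B K) × ∀ j : Fin t, B ⧸ IsLocalRing.maximalIdeal B ^ β j) ×
      ((Fin r → B) × (Fin s → K)))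

variable {K} in
omit [IsFractionRing B K] in
theorem HasTorsionSplitting.of_equiv {H H' : Type*} [IsLocalRing B] [AddCommGroup H] [Module B H]
    [AddCommGroup H'] [Module B H'] (h : HasTorsionSplitting B K H) (e : H' ≃ₗ[B] H) :
    HasTorsionSplitting B K H' := by
  obtain ⟨l, t, β, r, s, ⟨e'⟩⟩ := h
  exact ⟨l, t, β, r, s, ⟨e ≪≫ₗ e'⟩⟩

omit [IsFractionRing B K] in
theorem isFiniteModVectorSpace_of_finite_quotient {V Y : Type*} [AddCommGroup V] [Module K V]
    [Module B V] [IsScalarTower B K V] [Module.Finite K V] [AddCommGroup Y] [Module B Y]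
    (p : V →ₗ[B] Y) (hp : Module.Finite B (Y ⧸ LinearMap.range p)) :
    IsFiniteModVectorSpace B K Y := by
  let e := (Module.finBasis K V).equivFun.restrictScalars B
  refine ⟨_, p ∘ₗ e.symm.toLinearMap, ?_⟩
  rwa [LinearMap.range_comp_of_range_eq_top _ e.symm.range]

omit [IsFractionRing B K] in
theorem isFiniteModVectorSpace_pi [IsNoetherianRing B] {ι : Type*} [Finite ι] {Y : ι → Type*}
    [∀ i, AddCommGroup (Y i)] [∀ i, Module B (Y i)] (h : ∀ i, IsFiniteModVectorSpace B K (Y i)) :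
    IsFiniteModVectorSpace B K (∀ i, Y i) := by
  choose m p hp using h
  refine isFiniteModVectorSpace_of_finite_quotient K
    (LinearMap.pi fun i => p i ∘ₗ LinearMap.proj i : (∀ i, Fin (m i) → K) →ₗ[B] ∀ i, Y i) ?_
  refine finite_of_surjective_of_ker_le
    (LinearMap.pi fun i => (LinearMap.range (p i)).mkQ ∘ₗ LinearMap.proj i) (Submodule.mkQ _)
    (Submodule.mkQ_surjective _) fun y hy => ?_
  have hy' : ∀ i, ∃ v, p i v = y i := fun i =>
    (Submodule.Quotient.mk_eq_zero _).1 (congrFun hy i)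
  choose v hv using hy'
  exact (Submodule.Quotient.mk_eq_zero _).2 ⟨v, funext hv⟩

theorem exists_equiv_of_finite [IsDomain B] [IsDiscreteValuationRing B]
    (M : Type*) [AddCommGroup M] [Module B M] [Module.Finite B M] :
    ∃ (r t : ℕ) (β : Fin t → ℕ), Nonempty (M ≃ₗ[B] (Fin r → B) ×
      (∀ j : Fin t, B ⧸ IsLocalRing.maximalIdeal B ^ β j)) := by
  classical
  obtain ⟨r, ι, _, p, hp, e, ⟨E⟩⟩ := Module.equiv_free_prod_directSum B M
  have h : ∀ i, Submodule.span B {p i ^ e i} = IsLocalRing.maximalIdeal B ^ e i := fun i => by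
    rw [(IsDiscreteValuationRing.irreducible_iff_uniformizer _).1 (hp i), Ideal.span_singleton_pow]
  let ε := Fintype.equivFin ι
  exact ⟨r, Fintype.card ι, e ∘ ε.symm, ⟨E ≪≫ₗ
    (Finsupp.linearEquivFunOnFinite B B (Fin r)).prodCongr
      (DirectSum.linearEquivFunOnFintype B ι (fun i => B ⧸ Submodule.span B {p i ^ e i}) ≪≫ₗ
        LinearEquiv.piCongrRight (fun i => Submodule.quotEquivOfEq _ _ (h i)) ≪≫ₗ
        (LinearEquiv.piCongrLeft B
          (fun i => B ⧸ IsLocalRing.maximalIdeal B ^ e i) ε.symm).symm)⟩⟩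

variable [IsDomain B]

theorem hasTorsionSplitting_of_fg_ker [IsDiscreteValuationRing B] {V H : Type*}
    [AddCommGroup V] [Module K V] [Module B V] [IsScalarTower B K V] [Module.Finite K V]
    [AddCommGroup H] [Module B H] (φ : V →ₗ[B] H) (hker : (LinearMap.ker φ).FG)
    (hcoker : Module.Finite B (H ⧸ LinearMap.range φ)) : HasTorsionSplitting B K H := by
  let D := LinearMap.range φ
  obtain ⟨l, s, ⟨eD⟩⟩ := exists_equiv_of_surjective_of_fg_ker K φ.rangeRestrict
    φ.surjective_rangeRestrict (by rwa [LinearMap.ker_rangeRestrict])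
  obtain ⟨r, t, β, ⟨eF⟩⟩ := exists_equiv_of_finite (B := B) (H ⧸ D)
  have hD : Module.Baer B D := baer_of_forall_exists_smul_eq fun b hb x => by
    obtain ⟨v, rfl⟩ := φ.surjective_rangeRestrict x
    obtain ⟨w, rfl⟩ := exists_smul_eq_of_isFractionRing K hb v
    exact ⟨φ.rangeRestrict w, (map_smul _ _ _).symm⟩
  obtain ⟨ρ, hρ⟩ := hD.extension_property D.subtype D.injective_subtype LinearMap.id
  have e : (D × (H ⧸ D)) ≃ₗ[B] H :=
    lequivProdOfLeftSplitExact D.mkQ_surjective (by rw [D.range_subtype, D.ker_mkQ]) hρ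
  exact ⟨l, t, β, r, s, ⟨e.symm ≪≫ₗ
    eD.prodCongr (eF ≪≫ₗ LinearEquiv.prodComm B _ _) ≪≫ₗ LinearEquiv.prodProdProdComm B _ _ _ _ ≪≫ₗ
      (LinearEquiv.refl B _).prodCongr (LinearEquiv.prodComm B _ _)⟩⟩

section LinearHomology

variable {K} {U V X Y Z : Type*} [AddCommGroup U] [Module B U] [AddCommGroup V] [Module B V]
  [AddCommGroup X] [Module B X] [AddCommGroup Y] [Module B Y] [AddCommGroup Z] [Module B Z]

omit [IsDomain B] in
theorem fg_comap_range_of_finite_quotient [IsNoetherianRing B] (f : X →ₗ[B] Y) (q : U →ₗ[B] X)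
    [Module.Finite B (X ⧸ LinearMap.range q)] (j : V →ₗ[B] Y)
    (hj : Function.Injective ((LinearMap.range (f ∘ₗ q)).mkQ ∘ₗ j)) :
    ((LinearMap.range f).comap j).FG := by
  let fQ : (X ⧸ LinearMap.range q) →ₗ[B] (Y ⧸ LinearMap.range (f ∘ₗ q)) :=
    (LinearMap.range q).mapQ _ f (by rintro _ ⟨u, rfl⟩; exact ⟨u, rfl⟩)
  refine Submodule.fg_of_fg_map_injective _ hj ?_
  have : IsNoetherian B (((LinearMap.range f).comap j).map ((LinearMap.range (f ∘ₗ q)).mkQ ∘ₗ j)) :=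
    isNoetherian_of_le (t := LinearMap.range fQ) (by
      rintro _ ⟨v, ⟨x, hx⟩, rfl⟩
      exact ⟨Submodule.mkQ _ x, congrArg (Submodule.mkQ _) hx⟩)
  exact Module.Finite.iff_fg.1 inferInstance

omit [IsDomain B] in
theorem finite_linearHomology_quotient [IsNoetherianRing B] {f : X →ₗ[B] Y} {g : Y →ₗ[B] Z}
    (p : V →ₗ[B] Y) [Module.Finite B (Y ⧸ LinearMap.range p)]
    (D : Submodule B (LinearHomology f g))
    (hD : ∀ v (hv : p v ∈ LinearMap.ker g), Submodule.Quotient.mk ⟨p v, hv⟩ ∈ D) :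
    Module.Finite B (LinearHomology f g ⧸ D) := by
  refine finite_of_surjective_of_ker_le ((LinearMap.range p).mkQ ∘ₗ (LinearMap.ker g).subtype)
    (D.mkQ ∘ₗ Submodule.mkQ _) (D.mkQ_surjective.comp (Submodule.mkQ_surjective _)) ?_
  rintro ⟨y, hy⟩ hyp
  obtain ⟨v, rfl⟩ := (Submodule.Quotient.mk_eq_zero _).1 hyp
  exact (Submodule.Quotient.mk_eq_zero _).2 (hD v hy)

theorem hasTorsionSplitting_linearHomology [IsDiscreteValuationRing B]
    [Module.IsTorsionFree B Y] [Module.IsTorsionFree B Z]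
    (hX : IsFiniteModVectorSpace B K X) (hY : IsFiniteModVectorSpace B K Y)
    (f : X →ₗ[B] Y) (g : Y →ₗ[B] Z) : HasTorsionSplitting B K (LinearHomology f g) := by
  obtain ⟨_, q, hq⟩ := hX
  obtain ⟨m, p, hp⟩ := hY
  have := isTorsionFree_quotient_range K (f ∘ₗ q)
  let pQ : (Fin m → K) →ₗ[B] Y ⧸ LinearMap.range (f ∘ₗ q) := Submodule.mkQ _ ∘ₗ p
  -- `C` complements the vectors mapping to `im (f ∘ q)` among those mapping to cycles.
  obtain ⟨C, hC, hCV⟩ := IsModularLattice.exists_disjoint_and_sup_eq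
    (inf_le_right : kerSubspace K pQ ⊓ kerSubspace K (g ∘ₗ p) ≤ _)
  have hCker : ∀ v ∈ C, p v ∈ LinearMap.ker g := fun v hv => (hCV ▸ le_sup_right : C ≤ _) hv
  let pC : C →ₗ[B] Y := p ∘ₗ C.subtype.restrictScalars B
  let φ : C →ₗ[B] LinearHomology f g := Submodule.mkQ _ ∘ₗ
    pC.codRestrict (LinearMap.ker g) fun v => hCker v v.2
  have hφ : LinearMap.ker φ = (LinearMap.range f).comap pC :=
    Submodule.ext fun v => Submodule.Quotient.mk_eq_zero _
  have hpC : Function.Injective ((LinearMap.range (f ∘ₗ q)).mkQ ∘ₗ pC) := by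
    refine LinearMap.ker_eq_bot.1 (Submodule.eq_bot_iff _ |>.2 fun v hv => Subtype.ext ?_)
    exact Submodule.disjoint_def.1 hC v ⟨hv, hCker v v.2⟩ v.2
  refine hasTorsionSplitting_of_fg_ker K φ (hφ ▸ fg_comap_range_of_finite_quotient f q pC hpC)
    (finite_linearHomology_quotient p _ fun v hv => ?_)
  have hv' : v ∈ (kerSubspace K pQ ⊓ kerSubspace K (g ∘ₗ p)) ⊔ C := by rw [hCV]; exact hv
  obtain ⟨u, hu, c, hc, rfl⟩ := Submodule.mem_sup.1 hv'
  obtain ⟨x, hx⟩ := (Submodule.Quotient.mk_eq_zero _).1 hu.1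
  refine ⟨⟨c, hc⟩, (Submodule.Quotient.eq _).2 ⟨-q x, ?_⟩⟩
  change f (-q x) = p c - p (u + c)
  rw [map_neg, map_add, ← hx, LinearMap.comp_apply, sub_add_cancel_right]

end LinearHomology

end VectorSpaceByFinite

/-! ### Torsion and localization -/

section GammaTorsion

variable {A : Type*} [CommRing A] {J : Ideal A}
  {M N : Type*} [AddCommGroup M] [Module A M] [AddCommGroup N] [Module A N]

theorem map_mem_gammaTorsion (f : M →ₗ[A] N) {x : M} (hx : x ∈ gammaTorsion J M) :
    f x ∈ gammaTorsion J N := by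
  obtain ⟨m, hm⟩ := hx
  exact ⟨m, fun r hr => by rw [← map_smul, hm r hr, map_zero]⟩

theorem gammaTorsion_eq_bot [IsDomain A] [Module.IsTorsionFree A M] (hJ : J ≠ ⊥) :
    gammaTorsion J M = ⊥ := by
  refine (Submodule.eq_bot_iff _).2 ?_
  rintro x ⟨m, hm⟩
  obtain ⟨r, hr, hr0⟩ := Submodule.exists_mem_ne_zero_of_ne_bot (pow_ne_zero m hJ)
  exact (smul_eq_zero.1 (hm r hr)).resolve_left hr0

theorem gammaTorsion_prod_eq_top (hM : gammaTorsion J M = ⊤) (hN : gammaTorsion J N = ⊤) :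
    gammaTorsion J (M × N) = ⊤ := by
  refine Submodule.eq_top_iff'.2 fun ⟨x, y⟩ => ?_
  have hx := map_mem_gammaTorsion (LinearMap.inl A M N) (Submodule.eq_top_iff'.1 hM x)
  have hy := map_mem_gammaTorsion (LinearMap.inr A M N) (Submodule.eq_top_iff'.1 hN y)
  simpa using add_mem hx hy

theorem gammaTorsion_pi_eq_top {ι : Type*} [Finite ι] {M : ι → Type*} [∀ i, AddCommGroup (M i)]
    [∀ i, Module A (M i)] (hM : ∀ i, gammaTorsion J (M i) = ⊤) :
    gammaTorsion J (∀ i, M i) = ⊤ := by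
  classical
  have := Fintype.ofFinite ι
  refine Submodule.eq_top_iff'.2 fun x => ?_
  rw [← Finset.univ_sum_single x]
  exact Submodule.sum_mem _ fun i _ =>
    map_mem_gammaTorsion (LinearMap.single A M i) (Submodule.eq_top_iff'.1 (hM i) _)

theorem gammaTorsion_quotient_pow_eq_top (J : Ideal A) (n : ℕ) :
    gammaTorsion J (A ⧸ J ^ n) = ⊤ := by
  refine Submodule.eq_top_iff'.2 fun x => ⟨n, fun r hr => ?_⟩
  rw [Algebra.smul_def, Ideal.Quotient.algebraMap_eq, Ideal.Quotient.eq_zero_iff_mem.2 hr, zero_mul]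

theorem gammaTorsion_fractionQuotient_eq_top [IsDomain A] [IsDiscreteValuationRing A] (K : Type*)
    [Field K] [Algebra A K] [IsFractionRing A K] :
    gammaTorsion (IsLocalRing.maximalIdeal A) (FractionQuotient A K) = ⊤ := by
  refine Submodule.eq_top_iff'.2 fun x => ?_
  obtain ⟨k, rfl⟩ := Submodule.mkQ_surjective _ x
  obtain ⟨a, b, hb, rfl⟩ := IsFractionRing.div_surjective (A := A) k
  have hb0 : b ≠ 0 := nonZeroDivisors.ne_zero hb
  have hbK : algebraMap A K b ≠ 0 := by simpa using hb0
  obtain ⟨ϖ, hϖ⟩ := IsDiscreteValuationRing.exists_irreducible A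
  obtain ⟨n, hn⟩ := IsDiscreteValuationRing.associated_pow_irreducible hb0 hϖ
  refine ⟨n, fun r hr => ?_⟩
  rw [(IsDiscreteValuationRing.irreducible_iff_uniformizer _).1 hϖ, Ideal.span_singleton_pow,
    Ideal.mem_span_singleton] at hr
  obtain ⟨c, rfl⟩ := hn.dvd.trans hr
  rw [← map_smul]
  refine (Submodule.Quotient.mk_eq_zero _).2 ⟨c * a, ?_⟩
  rw [Algebra.linearMap_apply, Algebra.smul_def, map_mul, map_mul]
  field_simp

section Splitting

variable {H : Type*} [AddCommGroup H] [Module A H]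

theorem gammaTorsion_eq_ker_of_equiv_prod (hM : gammaTorsion J M = ⊤) (hN : gammaTorsion J N = ⊥)
    (e : H ≃ₗ[A] M × N) :
    gammaTorsion J H = LinearMap.ker (LinearMap.snd A M N ∘ₗ e.toLinearMap) := by
  apply le_antisymm
  · intro x hx
    exact (Submodule.eq_bot_iff _).1 hN _ (map_mem_gammaTorsion _ hx)
  · intro x hx
    have hx' : e.symm (LinearMap.inl A M N (e x).1) = x :=
      e.symm_apply_eq.2 (Prod.ext rfl (LinearMap.mem_ker.1 hx).symm)
    rw [← hx']
    exact map_mem_gammaTorsion (e.symm.toLinearMap ∘ₗ LinearMap.inl A M N)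
      (Submodule.eq_top_iff'.1 hM _)

theorem nonempty_gammaTorsion_equiv_of_equiv_prod (hM : gammaTorsion J M = ⊤)
    (hN : gammaTorsion J N = ⊥) (e : H ≃ₗ[A] M × N) : Nonempty (gammaTorsion J H ≃ₗ[A] M) := by
  let i : M →ₗ[A] H := e.symm.toLinearMap ∘ₗ LinearMap.inl A M N
  have hi : Function.Injective i := e.symm.injective.comp LinearMap.inl_injective
  have hrange : LinearMap.range i = gammaTorsion J H := by
    rw [gammaTorsion_eq_ker_of_equiv_prod hM hN e, LinearMap.ker_comp, LinearMap.ker_snd,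
      LinearMap.range_comp]
    exact (Submodule.comap_equiv_eq_map_symm e _).symm
  exact ⟨(LinearEquiv.ofInjective i hi ≪≫ₗ LinearEquiv.ofEq _ _ hrange).symm⟩

theorem nonempty_quotient_gammaTorsion_equiv_of_equiv_prod (hM : gammaTorsion J M = ⊤)
    (hN : gammaTorsion J N = ⊥) (e : H ≃ₗ[A] M × N) :
    Nonempty ((H ⧸ gammaTorsion J H) ≃ₗ[A] N) :=
  ⟨Submodule.quotEquivOfEq _ _ (gammaTorsion_eq_ker_of_equiv_prod hM hN e) ≪≫ₗ
    LinearMap.quotKerEquivOfSurjective (LinearMap.snd A M N ∘ₗ e.toLinearMap)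
      ((LinearMap.snd_surjective (R := A) (M := M) (M₂ := N)).comp e.surjective)⟩

end Splitting

section HasTorsionSplitting

variable [IsDomain A] [IsDiscreteValuationRing A] {K : Type*} [Field K] [Algebra A K]
  [IsFractionRing A K] {H : Type*} [AddCommGroup H] [Module A H]

theorem gammaTorsion_torsionSummand_eq_top (l : ℕ) {t : ℕ} (β : Fin t → ℕ) :
    gammaTorsion (IsLocalRing.maximalIdeal A) ((Fin l → FractionQuotient A K) ×
      ∀ j, A ⧸ IsLocalRing.maximalIdeal A ^ β j) = ⊤ :=
  gammaTorsion_prod_eq_top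
    (gammaTorsion_pi_eq_top fun _ => gammaTorsion_fractionQuotient_eq_top K)
    (gammaTorsion_pi_eq_top fun _ => gammaTorsion_quotient_pow_eq_top _ _)

theorem HasTorsionSplitting.gammaTorsion_equiv (h : HasTorsionSplitting A K H) :
    ∃ (l t : ℕ) (β : Fin t → ℕ), Nonempty (gammaTorsion (IsLocalRing.maximalIdeal A) H ≃ₗ[A]
      (Fin l → FractionQuotient A K) × ∀ j, A ⧸ IsLocalRing.maximalIdeal A ^ β j) := by
  obtain ⟨l, t, β, r, s, ⟨e⟩⟩ := h
  exact ⟨l, t, β, nonempty_gammaTorsion_equiv_of_equiv_prod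
    (gammaTorsion_torsionSummand_eq_top l β)
    (gammaTorsion_eq_bot (IsDiscreteValuationRing.not_a_field A)) e⟩

theorem HasTorsionSplitting.quotient_gammaTorsion_equiv (h : HasTorsionSplitting A K H) :
    ∃ r s : ℕ, Nonempty ((H ⧸ gammaTorsion (IsLocalRing.maximalIdeal A) H) ≃ₗ[A]
      (Fin r → A) × (Fin s → K)) := by
  obtain ⟨l, t, β, r, s, ⟨e⟩⟩ := h
  exact ⟨r, s, nonempty_quotient_gammaTorsion_equiv_of_equiv_prod
    (gammaTorsion_torsionSummand_eq_top l β)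
    (gammaTorsion_eq_bot (IsDiscreteValuationRing.not_a_field A)) e⟩

end HasTorsionSplitting

section RestrictScalars

variable (B : Type*) [CommRing B] [Algebra A B] [Module B M] [IsScalarTower A B M]

theorem forall_mem_map_smul_eq_zero_iff {x : M} :
    (∀ b ∈ J.map (algebraMap A B), b • x = 0) ↔ ∀ a ∈ J, a • x = 0 := by
  change J.map (algebraMap A B) ≤ LinearMap.ker (LinearMap.toSpanSingleton B M x) ↔ _
  refine Ideal.map_le_iff_le_comap.trans (forall₂_congr fun a _ => ?_)
  rw [Ideal.mem_comap, LinearMap.mem_ker, LinearMap.toSpanSingleton_apply, algebraMap_smul]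

theorem restrictScalars_gammaTorsion_map :
    (gammaTorsion (J.map (algebraMap A B)) M).restrictScalars A = gammaTorsion J M := by
  ext x
  refine exists_congr fun m => ?_
  rw [← Ideal.map_pow]
  exact forall_mem_map_smul_eq_zero_iff B

end RestrictScalars

section Localization

theorem exists_smul_eq_zero_of_fg_le_ker (S : Submonoid A) (f : M →ₗ[A] N) [IsLocalizedModule S f]
    {P : Submodule A M} (hP : P.FG) (h : P ≤ LinearMap.ker f) :
    ∃ s : S, ∀ x ∈ P, (s : A) • x = 0 := by
  induction P, hP using Submodule.fg_induction with
  | singleton x =>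
    obtain ⟨s, hs⟩ :=
      (IsLocalizedModule.eq_zero_iff S f).1 (h (Submodule.mem_span_singleton_self x))
    refine ⟨s, fun y hy => ?_⟩
    obtain ⟨a, rfl⟩ := Submodule.mem_span_singleton.1 hy
    rw [smul_comm, ← Submonoid.smul_def, hs, smul_zero]
  | sup P Q _ _ hP hQ =>
    obtain ⟨s, hs⟩ := hP (le_sup_left.trans h)
    obtain ⟨t, ht⟩ := hQ (le_sup_right.trans h)
    refine ⟨s * t, fun x hx => ?_⟩
    obtain ⟨y, hy, z, hz, rfl⟩ := Submodule.mem_sup.1 hx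
    rw [smul_add, Submonoid.coe_mul, mul_smul, mul_smul, ht z hz, smul_comm, hs y hy, smul_zero,
      smul_zero, add_zero]

variable (p : Ideal A) [p.IsMaximal]

theorem nonempty_gammaTorsion_equiv_of_isLocalizedModule (hp : p.FG) (f : M →ₗ[A] N)
    [IsLocalizedModule p.primeCompl f] :
    Nonempty (gammaTorsion p M ≃ₗ[A] gammaTorsion p N) := by
  refine ⟨.ofBijective (f.restrict fun x => map_mem_gammaTorsion f) ⟨?_, ?_⟩⟩
  · refine (injective_iff_map_eq_zero _).2 ?_
    rintro ⟨x, k, hk⟩ hx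
    obtain ⟨s, hs : (s : A) • x = 0⟩ := (IsLocalizedModule.eq_zero_iff p.primeCompl f).1
      (congrArg Subtype.val hx)
    obtain ⟨a, r, hr, har⟩ := Ideal.IsMaximal.exists_inv_pow p s.2 k
    refine Subtype.ext ?_
    calc x = a • (s : A) • x + r • x := by rw [smul_smul, ← add_smul, har, one_smul]
      _ = 0 := by rw [hs, hk r hr, smul_zero, add_zero]
  · rintro ⟨y, k, hk⟩
    obtain ⟨⟨x, s⟩, hxs : (s : A) • y = f x⟩ := IsLocalizedModule.surj p.primeCompl f y
    have hker : Submodule.map (LinearMap.toSpanSingleton A M x) (p ^ k) ≤ LinearMap.ker f := by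
      rintro _ ⟨r, hr, rfl⟩
      rw [LinearMap.mem_ker, LinearMap.toSpanSingleton_apply, map_smul, ← hxs, smul_comm, hk r hr,
        smul_zero]
    obtain ⟨t, ht⟩ :=
      exists_smul_eq_zero_of_fg_le_ker p.primeCompl f (Submodule.FG.map _ hp.pow) hker
    obtain ⟨a, r, hr, har⟩ := Ideal.IsMaximal.exists_inv_pow p (t * s).2 k
    refine ⟨⟨(a * t) • x, k, fun r hr => ?_⟩, Subtype.ext ?_⟩
    · have htr : (t : A) • r • x = 0 := ht _ ⟨r, hr, rfl⟩
      rw [smul_comm, mul_smul, htr, smul_zero]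
    · calc f ((a * t) • x) = (a * (t * s)) • y + r • y := by
            rw [map_smul, ← hxs, smul_smul, mul_assoc, hk r hr, add_zero]
        _ = y := by rw [← add_smul]; exact har ▸ one_smul A y

end Localization

end GammaTorsion

/-! ### Injective hulls of residue fields -/

section ResidueFieldHull

universe v

section Uniqueness

variable {A : Type v} [CommRing A] {N E E' : Type v} [AddCommGroup N] [Module A N]
  [AddCommGroup E] [Module A E] [AddCommGroup E'] [Module A E'] {ι : N →ₗ[A] E}

theorem IsInjectiveHull.injective_of_injective_comp (h : IsInjectiveHull ι) {f : E →ₗ[A] E'}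
    (hf : Function.Injective (f ∘ₗ ι)) : Function.Injective f := by
  refine LinearMap.ker_eq_bot.1 (h.essential _ ((Submodule.eq_bot_iff _).2 ?_))
  rintro _ ⟨hx, y, rfl⟩
  rw [hf ((LinearMap.mem_ker.1 hx).trans (map_zero (f ∘ₗ ι)).symm), map_zero]

theorem IsInjectiveHull.nonempty_equiv {ι' : N →ₗ[A] E'} (h : IsInjectiveHull ι)
    (h' : IsInjectiveHull ι') : Nonempty (E ≃ₗ[A] E') := by
  obtain ⟨f, hf⟩ := h'.moduleInjective.out ι h.injective ι'
  have hfι : f ∘ₗ ι = ι' := LinearMap.ext hf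
  have hf_inj : Function.Injective f := h.injective_of_injective_comp (hfι ▸ h'.injective)
  obtain ⟨g, hg⟩ := h.moduleInjective.out f hf_inj LinearMap.id
  have hgf : g ∘ₗ f = LinearMap.id := LinearMap.ext hg
  have hg_inj : Function.Injective g := h'.injective_of_injective_comp (by
    rw [← hfι, ← LinearMap.comp_assoc, hgf]
    exact h.injective)
  exact ⟨.ofBijective f ⟨hf_inj, fun y => ⟨g y, hg_inj (hg _)⟩⟩⟩

end Uniqueness

theorem injective_restrictScalars_of_flat {A B Q : Type v} [CommRing A] [CommRing B] [Algebra A B]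
    [Module.Flat A B] [AddCommGroup Q] [Module A Q] [Module B Q] [IsScalarTower A B Q]
    (h : Module.Injective B Q) : Module.Injective A Q := by
  refine ⟨fun X Y _ _ _ _ k hk g => ?_⟩
  obtain ⟨f, hf⟩ := h.out (k.baseChange B)
    (Module.Flat.lTensor_preserves_injective_linearMap k hk) (g.liftBaseChange B)
  refine ⟨f.restrictScalars A ∘ₗ TensorProduct.mk A B Y 1, fun x => ?_⟩
  simpa using hf (1 ⊗ₜ x)

theorem eq_bot_of_disjoint_torsionBySet {A E : Type*} [CommRing A] [AddCommGroup E] [Module A E]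
    {p : Ideal A} (hE : gammaTorsion p E = ⊤) {W : Submodule A E}
    (hW : Disjoint W (Submodule.torsionBySet A E p)) : W = ⊥ := by
  have key (k : ℕ) : ∀ x ∈ W, (∀ r ∈ p ^ k, r • x = 0) → x = 0 := by
    induction k with
    | zero => exact fun x _ hx => by simpa using hx 1
    | succ k ih =>
      refine fun x hxW hx => ih x hxW fun r hr => ?_
      refine Submodule.disjoint_def.1 hW _ (W.smul_mem r hxW) ?_
      refine (Submodule.mem_torsionBySet_iff _ _).2 fun s => ?_
      rw [smul_smul]
      exact hx _ (pow_succ' p k ▸ Ideal.mul_mem_mul s.2 hr)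
  refine (Submodule.eq_bot_iff _).2 fun x hx => ?_
  obtain ⟨k, hk⟩ := Submodule.eq_top_iff'.1 hE x
  exact key k x hx hk

section FractionQuotient

variable {B : Type*} (K : Type*) [CommRing B] [Field K] [Algebra B K] [IsFractionRing B K]

theorem exists_smul_eq_fractionQuotient {b : B} (hb : b ≠ 0) (x : FractionQuotient B K) :
    ∃ y, b • y = x := by
  obtain ⟨v, rfl⟩ := Submodule.mkQ_surjective _ x
  obtain ⟨w, rfl⟩ := exists_smul_eq_of_isFractionRing K hb v
  exact ⟨Submodule.mkQ _ w, (map_smul _ _ _).symm⟩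

theorem exists_injective_range_eq_torsionBySet {b : B} (hb : b ≠ 0) {J : Ideal B}
    (hJ : J = Ideal.span {b}) :
    ∃ j : (B ⧸ J) →ₗ[B] FractionQuotient B K, Function.Injective j ∧
      LinearMap.range j = Submodule.torsionBySet B (FractionQuotient B K) J := by
  subst hJ
  have hbK : algebraMap B K b ≠ 0 := by simpa using hb
  let π : K →ₗ[B] FractionQuotient B K := Submodule.mkQ _
  have hπ : ∀ x, π x = 0 ↔ ∃ c, algebraMap B K c = x := fun x => Submodule.Quotient.mk_eq_zero _
  let h : B →ₗ[B] FractionQuotient B K := LinearMap.toSpanSingleton B _ (π (algebraMap B K b)⁻¹)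
  have hker : Ideal.span {b} = LinearMap.ker h := by
    ext x
    rw [LinearMap.mem_ker, LinearMap.toSpanSingleton_apply, ← map_smul, hπ,
      Ideal.mem_span_singleton']
    refine exists_congr fun c => ?_
    rw [Algebra.smul_def, eq_mul_inv_iff_mul_eq₀ hbK, ← map_mul,
      (FaithfulSMul.algebraMap_injective B K).eq_iff]
  refine ⟨Submodule.liftQ _ h hker.le, LinearMap.ker_eq_bot.1 ?_, ?_⟩
  · exact Submodule.ker_liftQ_eq_bot _ _ _ hker.ge
  rw [Submodule.range_liftQ, Ideal.span, Submodule.torsionBySet_span_singleton_eq]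
  ext x
  obtain ⟨k, rfl⟩ := Submodule.mkQ_surjective _ x
  rw [Submodule.mem_torsionBy_iff, ← map_smul]
  constructor
  · rintro ⟨c, hc⟩
    rw [map_smul]
    exact hc ▸ (map_smul h b c).symm.trans
      (hker.le (Ideal.mul_mem_right c _ (Ideal.mem_span_singleton_self b)))
  · intro hk
    obtain ⟨c, hc⟩ := (hπ _).1 hk
    refine ⟨c, ?_⟩
    rw [LinearMap.toSpanSingleton_apply, ← map_smul, Algebra.smul_def, hc, Algebra.smul_def,
      mul_comm, inv_mul_cancel_left₀ hbK]

theorem nonempty_fractionQuotient_equiv_injectiveHull {A B K : Type v} [CommRing A] [CommRing B]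
    [Algebra A B] (p : Ideal A) [p.IsMaximal] [IsLocalization.AtPrime B p] [IsDomain B]
    [IsDiscreteValuationRing B] [Field K] [Algebra B K] [IsFractionRing B K] [Algebra A K]
    [IsScalarTower A B K] :
    Nonempty (FractionQuotient B K ≃ₗ[A] InjectiveHull A (A ⧸ p)) := by
  obtain ⟨ι, hι⟩ : ∃ ι : (A ⧸ p) →ₗ[A] InjectiveHull A (A ⧸ p), IsInjectiveHull ι :=
    (exists_isInjectiveHull A (A ⧸ p)).choose_spec
  have hmap := IsLocalization.AtPrime.map_eq_maximalIdeal p B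
  obtain ⟨ϖ, hϖ⟩ := IsDiscreteValuationRing.exists_irreducible B
  obtain ⟨j, hj, hjr⟩ := exists_injective_range_eq_torsionBySet K hϖ.ne_zero
    ((IsDiscreteValuationRing.irreducible_iff_uniformizer _).1 hϖ)
  let e : (A ⧸ p) ≃ₗ[A] B ⧸ IsLocalRing.maximalIdeal B :=
    (AlgEquiv.ofRingEquiv (f := IsLocalization.AtPrime.equivQuotMaximalIdeal p B)
      fun a => IsLocalization.AtPrime.equivQuotMaximalIdeal_apply_mk p B a).toLinearEquiv
  have : Module.Flat A B := IsLocalization.flat B p.primeCompl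
  have hinj : Module.Injective B (FractionQuotient B K) :=
    (baer_of_forall_exists_smul_eq fun _ => exists_smul_eq_fractionQuotient K).injective
  refine IsInjectiveHull.nonempty_equiv (ι := j.restrictScalars A ∘ₗ e.toLinearMap)
    ⟨injective_restrictScalars_of_flat hinj, hj.comp e.injective, fun W hW => ?_⟩ hι
  refine eq_bot_of_disjoint_torsionBySet (p := p) ?_ ?_
  · rw [← restrictScalars_gammaTorsion_map B, hmap, gammaTorsion_fractionQuotient_eq_top,
      Submodule.restrictScalars_top]
  · refine (disjoint_iff.2 hW).mono_right fun x hx => ?_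
    have hx' := (Submodule.mem_torsionBySet_iff _ _).1 hx
    have : x ∈ LinearMap.range j := by
      rw [hjr, Submodule.mem_torsionBySet_iff, ← hmap]
      exact Subtype.forall.2 ((forall_mem_map_smul_eq_zero_iff B).2 fun a ha => hx' ⟨a, ha⟩)
    obtain ⟨y, rfl⟩ := this
    exact ⟨e.symm y, congrArg j (e.apply_symm_apply y)⟩

end FractionQuotient

end ResidueFieldHull

/-! ### Completions of discrete valuation rings -/

section Completion

open IsLocalRing

section PrincipalMaximalIdeal

variable {R : Type*} [CommRing R] [IsLocalRing R] [IsHausdorff (maximalIdeal R) R] {ϖ : R}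

theorem exists_eq_pow_mul_unit (hϖ : maximalIdeal R = Ideal.span {ϖ}) {x : R} (hx : x ≠ 0) :
    ∃ (n : ℕ) (w : Rˣ), x = ϖ ^ n * w := by
  classical
  have hex : ∃ n, x ∉ maximalIdeal R ^ n := by
    by_contra! h
    refine hx (IsHausdorff.haus (I := maximalIdeal R) inferInstance x fun n => ?_)
    rw [SModEq.zero, smul_eq_mul, Ideal.mul_top]
    exact h n
  obtain ⟨n, hn⟩ : ∃ n, Nat.find hex = n + 1 :=
    Nat.exists_eq_succ_of_ne_zero fun h => Nat.find_spec hex (by simp [h])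
  have hmem : x ∈ maximalIdeal R ^ n :=
    not_not.1 (Nat.find_min hex (hn ▸ n.lt_succ_self))
  have hnmem : x ∉ maximalIdeal R ^ (n + 1) := hn ▸ Nat.find_spec hex
  rw [hϖ, Ideal.span_singleton_pow, Ideal.mem_span_singleton] at hmem
  obtain ⟨w, rfl⟩ := hmem
  have hw : IsUnit w := by
    by_contra hw
    have hwm : w ∈ maximalIdeal R := (mem_maximalIdeal w).2 hw
    rw [hϖ, Ideal.mem_span_singleton] at hwm
    refine hnmem ?_
    rw [hϖ, Ideal.span_singleton_pow, Ideal.mem_span_singleton, pow_succ]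
    exact mul_dvd_mul_left _ hwm
  exact ⟨n, hw.unit, rfl⟩

theorem isDomain_of_maximalIdeal_eq_span (hϖ : maximalIdeal R = Ideal.span {ϖ})
    (hnil : ¬ IsNilpotent ϖ) : IsDomain R := by
  have : NoZeroDivisors R := ⟨by
    intro x y hxy
    by_contra! h
    obtain ⟨m, v, rfl⟩ := exists_eq_pow_mul_unit hϖ h.1
    obtain ⟨n, w, rfl⟩ := exists_eq_pow_mul_unit hϖ h.2
    rw [mul_mul_mul_comm, ← pow_add, ← Units.val_mul, Units.mul_left_eq_zero] at hxy
    exact hnil ⟨m + n, hxy⟩⟩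
  exact NoZeroDivisors.to_isDomain R

theorem isDiscreteValuationRing_of_maximalIdeal_eq_span [IsDomain R]
    (hϖ : maximalIdeal R = Ideal.span {ϖ}) (h0 : ϖ ≠ 0) : IsDiscreteValuationRing R := by
  refine IsDiscreteValuationRing.ofHasUnitMulPowIrreducibleFactorization
    ⟨ϖ, ((Ideal.span_singleton_prime h0).1 ?_).irreducible, fun {x} hx => ?_⟩
  · rw [← hϖ]
    infer_instance
  · obtain ⟨n, w, hw⟩ := exists_eq_pow_mul_unit hϖ hx
    exact ⟨n, w, hw.symm⟩

end PrincipalMaximalIdeal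

variable (B : Type*) [CommRing B] [IsDomain B] [IsDiscreteValuationRing B]

theorem exists_maximalIdeal_adicCompletion_eq_span :
    ∃ ϖ : AdicCompletion (maximalIdeal B) B,
      maximalIdeal (AdicCompletion (maximalIdeal B) B) = Ideal.span {ϖ} ∧ ¬ IsNilpotent ϖ := by
  obtain ⟨ϖ, hϖ⟩ := IsDiscreteValuationRing.exists_irreducible B
  refine ⟨algebraMap B _ ϖ, ?_, fun ⟨n, hn⟩ => pow_ne_zero n hϖ.ne_zero ?_⟩
  · rw [AdicCompletion.maximalIdeal_eq_map,
      (IsDiscreteValuationRing.irreducible_iff_uniformizer ϖ).1 hϖ, Ideal.map_span,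
      Set.image_singleton]
  · rw [← map_pow] at hn
    exact (map_eq_zero_iff _ (AdicCompletion.of_injective (maximalIdeal B) B)).1 hn

instance isDomain_adicCompletion_maximalIdeal : IsDomain (AdicCompletion (maximalIdeal B) B) :=
  have ⟨_, hspan, hnil⟩ := exists_maximalIdeal_adicCompletion_eq_span B
  isDomain_of_maximalIdeal_eq_span hspan hnil

instance isDiscreteValuationRing_adicCompletion_maximalIdeal :
    IsDiscreteValuationRing (AdicCompletion (maximalIdeal B) B) :=
  have ⟨_, hspan, hnil⟩ := exists_maximalIdeal_adicCompletion_eq_span B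
  isDiscreteValuationRing_of_maximalIdeal_eq_span hspan fun h => hnil (h ▸ IsNilpotent.zero)

end Completion

/-! ### Localizations of polynomial rings at terms -/

section Laurent

open AddMonoidAlgebra (single)

section LaurentMap

variable {σ A : Type*} [CommRing A]

/-- An exponent vector of a polynomial, as an exponent vector of a Laurent polynomial. -/
def intExponent : (σ →₀ ℕ) →+ (σ → ℤ) where
  toFun e k := e k
  map_zero' := by ext; simp
  map_add' _ _ := by ext; simp

theorem intExponent_apply (e : σ →₀ ℕ) (k : σ) : intExponent e k = e k := rfl

theorem intExponent_injective : Function.Injective (intExponent (σ := σ)) := fun _ _ h =>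
  Finsupp.ext fun k => Nat.cast_injective (R := ℤ) (congrFun h k)

theorem exists_intExponent_eq_add_nsmul [Finite σ] {e : σ →₀ ℕ} {u : σ → ℤ}
    (hu : ∀ k, e k = 0 → 0 ≤ u k) :
    ∃ m, ∀ m' : ℕ, m ≤ m' → ∃ d, intExponent d = u + m' • intExponent e := by
  have := Fintype.ofFinite σ
  refine ⟨∑ k, (u k).natAbs, fun m' hm' => ?_⟩
  have hpos : ∀ k, 0 ≤ u k + m' * e k := fun k => by
    rcases Nat.eq_zero_or_pos (e k) with h | h
    · simpa [h] using hu k h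
    · have hk : (u k).natAbs ≤ m' * e k := by
        calc (u k).natAbs ≤ ∑ k, (u k).natAbs :=
              Finset.single_le_sum (f := fun k => (u k).natAbs) (by simp) (Finset.mem_univ k)
          _ ≤ m' := hm'
          _ ≤ m' * e k := Nat.le_mul_of_pos_right _ h
      zify at hk
      linarith [neg_abs_le (u k)]
  refine ⟨Finsupp.equivFunOnFinite.symm fun k => (u k + m' * e k).toNat, funext fun k => ?_⟩
  simpa [intExponent_apply] using hpos k

variable (σ A) (C : Type*) [CommRing C] [Algebra A C]

/-- The canonical map from polynomials over `A` to Laurent polynomials over an `A`-algebra `C`. -/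
noncomputable def laurentMap : MvPolynomial σ A →ₐ[A] AddMonoidAlgebra C (σ → ℤ) :=
  (AddMonoidAlgebra.mapDomainAlgHom A C intExponent).comp
    (AddMonoidAlgebra.mapAlgHom (σ →₀ ℕ) (Algebra.ofId A C))

variable {σ A}

theorem laurentMap_monomial (d : σ →₀ ℕ) (b : A) :
    laurentMap σ A C (MvPolynomial.monomial d b) = single (intExponent d) (algebraMap A C b) := by
  change AddMonoidAlgebra.mapDomain intExponent
    (AddMonoidAlgebra.mapAlgHom (σ →₀ ℕ) (Algebra.ofId A C) (single d b)) = _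
  rw [AddMonoidAlgebra.mapAlgHom_single, AddMonoidAlgebra.mapDomain_single]
  rfl

variable {C}

theorem map_eq_zero_of_laurentMap_eq_zero {p : MvPolynomial σ A} (hp : laurentMap σ A C p = 0) :
    MvPolynomial.map (algebraMap A C) p = 0 :=
  AddMonoidAlgebra.mapDomain_injective intExponent_injective
    (hp.trans (map_zero (AddMonoidAlgebra.mapDomainAlgHom A C intExponent)).symm)

theorem coeff_laurentMap_eq_zero {v : σ → ℤ} (hv : v ∉ Set.range intExponent)
    (p : MvPolynomial σ A) : (laurentMap σ A C p).coeff v = 0 :=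
  Finsupp.mapDomain_of_notMem_range _ v hv

end LaurentMap

section AwayLaurent

variable {A : Type*} [CommRing A] {n : ℕ} {f : MvPolynomial (Fin n) A} {e : Fin n →₀ ℕ} {α : A}

theorem laurentMap_pow (hf : f = MvPolynomial.monomial e α) (m : ℕ) :
    laurentMap (Fin n) A (Localization.Away α) (f ^ m) =
      single (m • intExponent e) (algebraMap A _ (α ^ m)) := by
  rw [hf, MvPolynomial.monomial_pow, laurentMap_monomial, map_nsmul]

theorem isUnit_laurentMap (hf : f = MvPolynomial.monomial e α) :
    IsUnit (laurentMap (Fin n) A (Localization.Away α) f) := by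
  obtain ⟨β, hβ⟩ := isUnit_iff_exists_inv.1
    (IsLocalization.Away.algebraMap_isUnit (S := Localization.Away α) α)
  refine isUnit_iff_exists_inv.2 ⟨single (-intExponent e) β, ?_⟩
  rw [hf, laurentMap_monomial, AddMonoidAlgebra.single_mul_single, hβ, add_neg_cancel,
    AddMonoidAlgebra.one_def]

/-- The embedding of the localization of a polynomial ring at a term `α Xᵉ` into the Laurent
polynomials over `A_α`. -/
noncomputable def awayLaurent (hf : f = MvPolynomial.monomial e α) : Localization.Away f →ₐ[A]
    AddMonoidAlgebra (Localization.Away α) (Fin n → ℤ) :=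
  IsLocalization.liftAlgHom (M := Submonoid.powers f) (f := laurentMap (Fin n) A _) (by
    rintro ⟨_, m, rfl⟩
    rw [map_pow]
    exact (isUnit_laurentMap hf).pow m)

theorem awayLaurent_algebraMap (hf : f = MvPolynomial.monomial e α) (p : MvPolynomial (Fin n) A) :
    awayLaurent hf (algebraMap _ _ p) = laurentMap (Fin n) A _ p :=
  IsLocalization.lift_eq _ _

theorem algebraMap_away_eq_zero_of_laurentMap_eq_zero (hf : f = MvPolynomial.monomial e α)
    {p : MvPolynomial (Fin n) A} (hp : laurentMap (Fin n) A (Localization.Away α) p = 0) :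
    algebraMap _ (Localization.Away f) p = 0 := by
  let _ : Algebra (MvPolynomial (Fin n) A) (MvPolynomial (Fin n) (Localization.Away α)) :=
    MvPolynomial.algebraMvPolynomial
  obtain ⟨⟨_, _, ⟨m, rfl⟩, rfl⟩, hm⟩ := (IsLocalization.map_eq_zero_iff
    ((Submonoid.powers α).map MvPolynomial.C) (MvPolynomial (Fin n) (Localization.Away α)) p).1
      (map_eq_zero_of_laurentMap_eq_zero hp)
  refine (IsLocalization.map_eq_zero_iff (Submonoid.powers f) _ p).2 ⟨⟨f ^ m, m, rfl⟩, ?_⟩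
  have hfm : f ^ m = MvPolynomial.monomial (m • e) 1 * MvPolynomial.C (α ^ m) := by
    rw [hf, MvPolynomial.monomial_pow, mul_comm, MvPolynomial.C_mul_monomial, mul_one]
  calc f ^ m * p = MvPolynomial.monomial (m • e) 1 * (MvPolynomial.C (α ^ m) * p) := by
        rw [hfm, mul_assoc]
    _ = 0 := by rw [show MvPolynomial.C (α ^ m) * p = 0 from hm, mul_zero]

theorem awayLaurent_injective (hf : f = MvPolynomial.monomial e α) :
    Function.Injective (awayLaurent hf) := by
  refine (injective_iff_map_eq_zero _).2 fun x hx => ?_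
  obtain ⟨p, s, rfl⟩ := IsLocalization.exists_mk'_eq (Submonoid.powers f) x
  have hp : laurentMap (Fin n) A (Localization.Away α) p = 0 := by
    rw [← awayLaurent_algebraMap hf, ← IsLocalization.mk'_spec _ p s, map_mul, hx, zero_mul]
  rw [IsLocalization.mk'_eq_mul_mk'_one,
    algebraMap_away_eq_zero_of_laurentMap_eq_zero hf hp, zero_mul]

theorem awayLaurent_awayMap {f' : MvPolynomial (Fin n) A} {e' : Fin n →₀ ℕ} {α' : A}
    (hf : f = MvPolynomial.monomial e α) (hf' : f' = MvPolynomial.monomial e' α')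
    (h : f ∣ f') (hα : α ∣ α') (x : Localization.Away f) :
    awayLaurent hf' (awayMap h x) =
      AddMonoidAlgebra.mapAlgHom (Fin n → ℤ) (awayMap hα) (awayLaurent hf x) := by
  suffices (awayLaurent hf').comp ((awayMap h).restrictScalars A) =
      (AddMonoidAlgebra.mapAlgHom (Fin n → ℤ) (awayMap hα)).comp (awayLaurent hf) from
    DFunLike.congr_fun this x
  refine IsLocalization.algHom_ext (Submonoid.powers f) (MvPolynomial.algHom_ext fun k => ?_)
  change awayLaurent hf' (awayMap h (algebraMap _ _ (MvPolynomial.X k))) =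
    AddMonoidAlgebra.mapAlgHom _ (awayMap hα) (awayLaurent hf (algebraMap _ _ (MvPolynomial.X k)))
  rw [AlgHom.commutes, awayLaurent_algebraMap, awayLaurent_algebraMap, MvPolynomial.X,
    laurentMap_monomial, laurentMap_monomial, AddMonoidAlgebra.mapAlgHom_single, AlgHom.commutes]

/-- The coefficient of `Xᵘ` of an element of the localization of a polynomial ring at `α Xᵉ`. -/
noncomputable def awayCoeff (hf : f = MvPolynomial.monomial e α) (u : Fin n → ℤ) :
    Localization.Away f →ₗ[A] Localization.Away α where
  toFun x := (awayLaurent hf x).coeff u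
  map_add' x y := by rw [map_add]; rfl
  map_smul' r x := by rw [map_smul]; rfl

theorem awayCoeff_apply (hf : f = MvPolynomial.monomial e α) (u : Fin n → ℤ)
    (x : Localization.Away f) : awayCoeff hf u x = (awayLaurent hf x).coeff u := rfl

theorem awayCoeff_awayMap {f' : MvPolynomial (Fin n) A} {e' : Fin n →₀ ℕ} {α' : A}
    (hf : f = MvPolynomial.monomial e α) (hf' : f' = MvPolynomial.monomial e' α')
    (h : f ∣ f') (hα : α ∣ α') (u : Fin n → ℤ) (x : Localization.Away f) :
    awayCoeff hf' u (awayMap h x) = awayMap hα (awayCoeff hf u x) := by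
  rw [awayCoeff_apply, awayLaurent_awayMap hf hf' h hα, AddMonoidAlgebra.coeff_mapAlgHom]
  rfl

theorem awayCoeff_eq_zero (hf : f = MvPolynomial.monomial e α) {u : Fin n → ℤ}
    (hu : ¬ ∀ k, e k = 0 → 0 ≤ u k) (x : Localization.Away f) : awayCoeff hf u x = 0 := by
  obtain ⟨p, ⟨_, m, rfl⟩, rfl⟩ := IsLocalization.exists_mk'_eq (Submonoid.powers f) x
  set x := IsLocalization.mk' (Localization.Away f) p (⟨f ^ m, m, rfl⟩ : Submonoid.powers f)
  have hv : u + m • intExponent e ∉ Set.range intExponent := by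
    rintro ⟨d, hd⟩
    refine hu fun k hk => ?_
    have hdk : (d k : ℤ) = u k := by simpa [intExponent_apply, hk] using congrFun hd k
    exact hdk ▸ Int.natCast_nonneg _
  have hx : awayLaurent hf x * single (m • intExponent e) (algebraMap A _ (α ^ m)) =
      laurentMap (Fin n) A _ p := by
    rw [← laurentMap_pow hf, ← awayLaurent_algebraMap hf, ← map_mul, ← awayLaurent_algebraMap hf]
    exact congrArg _ (IsLocalization.mk'_spec _ _ _)
  have hunit : IsUnit (algebraMap A (Localization.Away α) (α ^ m)) := by
    rw [map_pow]
    exact (IsLocalization.Away.algebraMap_isUnit α).pow m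
  rw [awayCoeff_apply, ← hunit.mul_left_eq_zero, ← coeff_laurentMap_eq_zero hv p, ← hx,
    AddMonoidAlgebra.coeff_mul_single_apply, add_neg_cancel_right]

theorem awayLaurent_eq_single (hf : f = MvPolynomial.monomial e α) {u : Fin n → ℤ}
    {x : Localization.Away f} {y : Localization.Away α} {m : ℕ} {d : Fin n →₀ ℕ} {b : A}
    (hd : intExponent d = u + m • intExponent e)
    (hx : x * algebraMap (MvPolynomial (Fin n) A) _ (f ^ m) =
      algebraMap (MvPolynomial (Fin n) A) _ (MvPolynomial.monomial d b))
    (hy : y * algebraMap A _ (α ^ m) = algebraMap A _ b) :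
    awayLaurent hf x = single u y := by
  refine ((isUnit_laurentMap hf).pow m).mul_right_cancel ?_
  calc awayLaurent hf x * laurentMap (Fin n) A _ f ^ m
      = single (intExponent d) (algebraMap A _ b) := by
        rw [← map_pow, ← awayLaurent_algebraMap hf, ← map_mul, hx, awayLaurent_algebraMap,
          laurentMap_monomial]
    _ = single u y * laurentMap (Fin n) A _ f ^ m := by
        rw [← map_pow, laurentMap_pow hf, AddMonoidAlgebra.single_mul_single, hd, hy]

theorem forall_sub_mul_eq_iff {d e : Fin n →₀ ℕ} {m : ℕ} {u : Fin n → ℤ} :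
    (∀ k, (d k : ℤ) - m * e k = u k) ↔ intExponent d = u + m • intExponent e := by
  simp [funext_iff, intExponent_apply, sub_eq_iff_eq_add]

theorem exists_awayLaurent_eq_single (hf : f = MvPolynomial.monomial e α) {u : Fin n → ℤ}
    {x : Localization.Away f} (hx : x ∈ awayDegree f e u) :
    ∃ y, awayLaurent hf x = single u y := by
  induction hx using Submodule.span_induction with
  | mem x hx =>
    obtain ⟨m, d, b, hd, hx⟩ := hx
    exact ⟨_, awayLaurent_eq_single hf (forall_sub_mul_eq_iff.1 hd) hx
      (IsLocalization.mk'_spec _ b (⟨α ^ m, m, rfl⟩ : Submonoid.powers α))⟩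
  | zero => exact ⟨0, by rw [map_zero, AddMonoidAlgebra.single_zero]⟩
  | smul a x _ hx =>
    obtain ⟨y, hy⟩ := hx
    exact ⟨a • y, by rw [map_smul, hy, AddMonoidAlgebra.smul_single]⟩
  | add x y _ _ hx hy =>
    obtain ⟨v, hv⟩ := hx
    obtain ⟨w, hw⟩ := hy
    exact ⟨v + w, by rw [map_add, hv, hw, AddMonoidAlgebra.single_add]⟩

theorem exists_mem_awayDegree_awayLaurent_eq_single (hf : f = MvPolynomial.monomial e α)
    {u : Fin n → ℤ} (hu : ∀ k, e k = 0 → 0 ≤ u k) (y : Localization.Away α) :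
    ∃ x ∈ awayDegree f e u, awayLaurent hf x = single u y := by
  obtain ⟨b, ⟨_, k, rfl⟩, rfl⟩ := IsLocalization.exists_mk'_eq (Submonoid.powers α) y
  obtain ⟨m, hm⟩ := exists_intExponent_eq_add_nsmul hu
  obtain ⟨d, hd⟩ := hm (k + m) (Nat.le_add_left m k)
  let s : Submonoid.powers f := ⟨f ^ (k + m), k + m, rfl⟩
  have hx := IsLocalization.mk'_spec (Localization.Away f)
    (MvPolynomial.monomial d (b * α ^ m)) s
  refine ⟨_, Submodule.subset_span ⟨k + m, d, _, forall_sub_mul_eq_iff.2 hd, hx⟩,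
    awayLaurent_eq_single hf hd hx ?_⟩
  rw [pow_add, map_mul, ← mul_assoc, map_mul]
  exact congrArg (· * _) (IsLocalization.mk'_spec _ b (⟨α ^ k, k, rfl⟩ : Submonoid.powers α))

theorem mem_awayDegree_iff (hf : f = MvPolynomial.monomial e α) {u : Fin n → ℤ}
    {x : Localization.Away f} :
    x ∈ awayDegree f e u ↔ awayLaurent hf x = single u (awayCoeff hf u x) := by
  constructor
  · intro hx
    obtain ⟨y, hy⟩ := exists_awayLaurent_eq_single hf hx
    rw [awayCoeff_apply, hy, AddMonoidAlgebra.coeff_single, Finsupp.single_eq_same]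
  · intro hx
    by_cases hu : ∀ k, e k = 0 → 0 ≤ u k
    · obtain ⟨x', hx', h⟩ := exists_mem_awayDegree_awayLaurent_eq_single hf hu (awayCoeff hf u x)
      exact awayLaurent_injective hf (hx.trans h.symm) ▸ hx'
    · rw [awayCoeff_eq_zero hf hu, AddMonoidAlgebra.single_zero,
        map_eq_zero_iff _ (awayLaurent_injective hf)] at hx
      exact hx ▸ Submodule.zero_mem _

theorem eq_zero_of_mem_awayDegree (hf : f = MvPolynomial.monomial e α) {u : Fin n → ℤ}
    {x : Localization.Away f} (hx : x ∈ awayDegree f e u) (h : awayCoeff hf u x = 0) : x = 0 := by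
  rw [mem_awayDegree_iff hf, h, AddMonoidAlgebra.single_zero] at hx
  exact (map_eq_zero_iff _ (awayLaurent_injective hf)).1 hx

theorem exists_mem_awayDegree_awayCoeff_eq (hf : f = MvPolynomial.monomial e α) {u : Fin n → ℤ}
    (hu : ∀ k, e k = 0 → 0 ≤ u k) (y : Localization.Away α) :
    ∃ x ∈ awayDegree f e u, awayCoeff hf u x = y := by
  obtain ⟨x, hx, hxy⟩ := exists_mem_awayDegree_awayLaurent_eq_single hf hu y
  exact ⟨x, hx, by
    rw [awayCoeff_apply, hxy, AddMonoidAlgebra.coeff_single, Finsupp.single_eq_same]⟩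

theorem awayMap_mem_awayDegree {f' : MvPolynomial (Fin n) A} {e' : Fin n →₀ ℕ} {α' : A}
    (hf : f = MvPolynomial.monomial e α) (hf' : f' = MvPolynomial.monomial e' α')
    (h : f ∣ f') (hα : α ∣ α') {u : Fin n → ℤ} {x : Localization.Away f}
    (hx : x ∈ awayDegree f e u) : awayMap h x ∈ awayDegree f' e' u := by
  rw [mem_awayDegree_iff hf] at hx
  rw [mem_awayDegree_iff hf', awayCoeff_awayMap hf hf' h hα, awayLaurent_awayMap hf hf' h hα, hx,
    AddMonoidAlgebra.mapAlgHom_single]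

end AwayLaurent

end Laurent

/-! ### The Čech complex supported on a set of index sets -/

section SupportedCech

section Definition

variable {R : Type*} [CommRing R] {c : ℕ}

/-- The `k`-cochains of the Čech complex on `a` that are supported on `Δ`. -/
abbrev SupportedCochain (a : Fin c → R) (Δ : Set (Finset (Fin c))) (k : ℕ) : Type _ :=
  ∀ S : {S : Finset (Fin c) // S ∈ Δ ∧ S.card = k}, Localization.Away (∏ j ∈ S.1, a j)

open Classical in
/-- The Čech differential `k → l` on the cochains supported on `Δ`. It is meant for `l = k + 1`, but
it is defined for all `l`, and it vanishes for `l = 0`: so `supportedD a Δ (i - 1) i` is the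
differential into degree `i` even for `i = 0`. -/
noncomputable def supportedD (a : Fin c → R) (Δ : Set (Finset (Fin c))) (k l : ℕ) :
    SupportedCochain a Δ k →ₗ[R] SupportedCochain a Δ l :=
  LinearMap.pi fun S => ∑ j : S.1,
    if h : S.1.erase j.1 ∈ Δ ∧ (S.1.erase j.1).card = k then
      (-1 : R) ^ (S.1.filter (· < j.1)).card •
        ((awayMap (Finset.prod_dvd_prod_of_subset _ _ a
            (Finset.erase_subset j.1 S.1))).toLinearMap ∘ₗ
          LinearMap.proj (⟨S.1.erase j.1, h⟩ : {S : Finset (Fin c) // S ∈ Δ ∧ S.card = k}))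
    else 0

/-- The `i`-th cohomology of the Čech complex supported on `Δ`. -/
abbrev SupportedCohomology (a : Fin c → R) (Δ : Set (Finset (Fin c))) (i : ℕ) : Type _ :=
  LinearHomology (supportedD a Δ (i - 1) i) (supportedD a Δ i (i + 1))

open Classical in
theorem supportedD_apply (a : Fin c → R) (Δ : Set (Finset (Fin c))) (k l : ℕ)
    (x : SupportedCochain a Δ k) (S : {S : Finset (Fin c) // S ∈ Δ ∧ S.card = l}) :
    supportedD a Δ k l x S = ∑ j : S.1,
      if h : S.1.erase j.1 ∈ Δ ∧ (S.1.erase j.1).card = k then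
        (-1 : R) ^ (S.1.filter (· < j.1)).card •
          awayMap (Finset.prod_dvd_prod_of_subset _ _ a (Finset.erase_subset j.1 S.1))
            (x ⟨S.1.erase j.1, h⟩)
      else 0 := by
  rw [supportedD, LinearMap.pi_apply, LinearMap.sum_apply]
  refine Finset.sum_congr rfl fun j _ => ?_
  split_ifs <;> rfl

theorem supportedD_zero_right (a : Fin c → R) (Δ : Set (Finset (Fin c))) (k : ℕ) :
    supportedD a Δ k 0 = 0 := by
  refine LinearMap.ext fun x => funext fun S => ?_
  rw [supportedD_apply]
  have : IsEmpty S.1 := Finset.isEmpty_coe_sort.2 (Finset.card_eq_zero.1 S.2.2)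
  exact Finset.sum_of_isEmpty _

theorem cechD_apply (f : Fin c → R) (k : ℕ) (x : CechCochain f k)
    (S : {S : Finset (Fin c) // S.card = k + 1}) :
    cechD f k x S = ∑ j : S.1, (-1 : R) ^ (S.1.filter (· < j.1)).card •
      awayMap (Finset.prod_dvd_prod_of_subset _ _ f (Finset.erase_subset j.1 S.1))
        (x ⟨S.1.erase j.1, by rw [Finset.card_erase_of_mem j.2, S.2]; rfl⟩) := by
  simp [cechD]

theorem neg_one_pow_smul_eq (A : Type*) {M : Type*} [CommRing A] [Algebra A R]
    [AddCommGroup M] [Module A M] [Module R M] [IsScalarTower A R M] (m : ℕ) (y : M) :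
    (-1 : R) ^ m • y = (-1 : A) ^ m • y := by
  rw [← algebraMap_smul R ((-1 : A) ^ m), map_pow, map_neg, map_one]

end Definition

section Coefficients

variable {A : Type*} [CommRing A] {n c : ℕ} (a : Fin c → A) (ξ : Fin c → Fin n →₀ ℕ)
  (u : Fin n → ℤ)

/-- The index sets `S` for which the localization of `A[X₁, …, X_n]` at `∏_{j ∈ S} a_j X^{ξ_j}` may
be nonzero in degree `u`. -/
def degreeSupport : Set (Finset (Fin c)) :=
  {S | ∀ k, (∑ j ∈ S, ξ j) k = 0 → 0 ≤ u k}

theorem prod_cMonomial (S : Finset (Fin c)) :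
    ∏ j ∈ S, cMonomial a ξ j = MvPolynomial.monomial (∑ j ∈ S, ξ j) (∏ j ∈ S, a j) :=
  (MvPolynomial.monomial_sum_prod S ξ a).symm

/-- Taking the coefficient of `Xᵘ` of Čech cochains. -/
noncomputable def cechCoeff (k : ℕ) :
    CechCochain (cMonomial a ξ) k →ₗ[A] SupportedCochain a (degreeSupport ξ u) k :=
  LinearMap.pi fun S =>
    awayCoeff (prod_cMonomial a ξ S.1) u ∘ₗ
      LinearMap.proj (⟨S.1, S.2.2⟩ : {S : Finset (Fin c) // S.card = k})

theorem cechCoeff_apply {k : ℕ} (x : CechCochain (cMonomial a ξ) k)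
    (S : {S : Finset (Fin c) // S ∈ degreeSupport ξ u ∧ S.card = k}) :
    cechCoeff a ξ u k x S = awayCoeff (prod_cMonomial a ξ S.1) u (x ⟨S.1, S.2.2⟩) := rfl

theorem cechCoeff_cechD (k : ℕ) (x : CechCochain (cMonomial a ξ) k) :
    cechCoeff a ξ u (k + 1) (cechD _ k x) =
      supportedD a (degreeSupport ξ u) k (k + 1) (cechCoeff a ξ u k x) := by
  classical
  ext S
  rw [cechCoeff_apply, cechD_apply, supportedD_apply, map_sum]
  refine Finset.sum_congr rfl fun j _ => ?_
  have hcard : (S.1.erase j.1).card = k := by rw [Finset.card_erase_of_mem j.2, S.2.2]; rfl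
  rw [neg_one_pow_smul_eq A, map_smul, awayCoeff_awayMap (prod_cMonomial a ξ _) _ _
    (Finset.prod_dvd_prod_of_subset _ _ a (Finset.erase_subset j.1 S.1))]
  split_ifs with h
  · rfl
  · rw [awayCoeff_eq_zero _ fun hS => h ⟨hS, hcard⟩, map_zero, smul_zero]

variable {a ξ u}

theorem mem_cechDegree_iff {k : ℕ} {x : CechCochain (cMonomial a ξ) k} :
    x ∈ cechDegree a ξ k u ↔
      ∀ S, x S ∈ awayDegree (∏ j ∈ S.1, cMonomial a ξ j) (∑ j ∈ S.1, ξ j) u :=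
  ⟨fun h S => h S trivial, fun h S _ => h S⟩

theorem cechD_mem_cechDegree {k : ℕ} {x : CechCochain (cMonomial a ξ) k}
    (hx : x ∈ cechDegree a ξ k u) : cechD _ k x ∈ cechDegree a ξ (k + 1) u := by
  refine mem_cechDegree_iff.2 fun S => ?_
  rw [cechD_apply]
  refine Submodule.sum_mem _ fun j _ => ?_
  have hj := awayMap_mem_awayDegree (prod_cMonomial a ξ (S.1.erase j.1)) (prod_cMonomial a ξ S.1)
    (Finset.prod_dvd_prod_of_subset _ _ (cMonomial a ξ) (Finset.erase_subset j.1 S.1))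
    (Finset.prod_dvd_prod_of_subset _ _ a (Finset.erase_subset j.1 S.1))
    (mem_cechDegree_iff.1 hx ⟨S.1.erase j.1, by rw [Finset.card_erase_of_mem j.2, S.2]; rfl⟩)
  rw [neg_one_pow_smul_eq A]
  exact Submodule.smul_mem _ _ hj

theorem eq_zero_of_mem_cechDegree {k : ℕ} {x : CechCochain (cMonomial a ξ) k}
    (hx : x ∈ cechDegree a ξ k u) (h : cechCoeff a ξ u k x = 0) : x = 0 := by
  ext S
  refine eq_zero_of_mem_awayDegree (prod_cMonomial a ξ S.1) (mem_cechDegree_iff.1 hx S) ?_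
  by_cases hS : S.1 ∈ degreeSupport ξ u
  · exact congrFun h ⟨S.1, hS, S.2⟩
  · exact awayCoeff_eq_zero _ hS _

theorem exists_mem_cechDegree_cechCoeff_eq {k : ℕ}
    (y : SupportedCochain a (degreeSupport ξ u) k) :
    ∃ x ∈ cechDegree a ξ k u, cechCoeff a ξ u k x = y := by
  have h : ∀ S : {S : Finset (Fin c) // S.card = k},
      ∃ x ∈ awayDegree (∏ j ∈ S.1, cMonomial a ξ j) (∑ j ∈ S.1, ξ j) u,
        ∀ hS : S.1 ∈ degreeSupport ξ u,
          awayCoeff (prod_cMonomial a ξ S.1) u x = y ⟨S.1, hS, S.2⟩ := fun S => by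
    by_cases hS : S.1 ∈ degreeSupport ξ u
    · obtain ⟨x, hx, hxy⟩ := exists_mem_awayDegree_awayCoeff_eq (prod_cMonomial a ξ S.1) hS
        (y ⟨S.1, hS, S.2⟩)
      exact ⟨x, hx, fun _ => hxy⟩
    · exact ⟨0, Submodule.zero_mem _, fun h => absurd h hS⟩
  choose x hx hxy using h
  exact ⟨x, mem_cechDegree_iff.2 hx, funext fun S => hxy ⟨S.1, S.2.2⟩ S.2.1⟩

theorem mem_cechCoboundaries_iff {i : ℕ} {x : CechCochain (cMonomial a ξ) i}
    (hx : x ∈ cechDegree a ξ i u) : x ∈ cechCoboundaries (cMonomial a ξ) i ↔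
      cechCoeff a ξ u i x ∈ LinearMap.range (supportedD a (degreeSupport ξ u) (i - 1) i) := by
  cases i with
  | zero =>
    rw [supportedD_zero_right, LinearMap.range_zero, Submodule.mem_bot]
    exact ⟨fun h => by rw [(Submodule.mem_bot _).1 h, map_zero], eq_zero_of_mem_cechDegree hx⟩
  | succ i =>
    constructor
    · rintro ⟨w, rfl⟩
      exact ⟨cechCoeff a ξ u i w, (cechCoeff_cechD a ξ u i w).symm⟩
    · rintro ⟨v, hv⟩
      obtain ⟨w, hw, rfl⟩ := exists_mem_cechDegree_cechCoeff_eq v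
      refine ⟨w, (sub_eq_zero.1 (eq_zero_of_mem_cechDegree
        (Submodule.sub_mem _ hx (cechD_mem_cechDegree hw)) ?_)).symm⟩
      rw [map_sub, cechCoeff_cechD, ← hv]
      exact sub_self _

variable (a ξ u)

theorem nonempty_localCohomologyDegree_equiv (i : ℕ) :
    Nonempty (localCohomologyDegree a ξ i u ≃ₗ[A]
      SupportedCohomology a (degreeSupport ξ u) i) := by
  let N : Submodule A (cechCocycles (cMonomial a ξ) i) := (cechDegree a ξ i u).comap
    ((cechCocycles (cMonomial a ξ) i).subtype.restrictScalars A)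
  let Q := (cechCoboundaries (cMonomial a ξ) i).submoduleOf (cechCocycles (cMonomial a ξ) i)
  let classOf : N →ₗ[A] localCohomologyDegree a ξ i u := (Q.mkQ.restrictScalars A).submoduleMap N
  let coeff : N →ₗ[A] LinearMap.ker (supportedD a (degreeSupport ξ u) i (i + 1)) :=
    (cechCoeff a ξ u i ∘ₗ (cechCocycles (cMonomial a ξ) i).subtype.restrictScalars A ∘ₗ
      N.subtype).codRestrict _ fun z => by
        change supportedD _ _ _ _ (cechCoeff a ξ u i z.1.1) = 0
        rw [← cechCoeff_cechD, LinearMap.mem_ker.1 z.1.2, map_zero]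
  let W := (LinearMap.range (supportedD a (degreeSupport ξ u) (i - 1) i)).submoduleOf
    (LinearMap.ker (supportedD a (degreeSupport ξ u) i (i + 1)))
  have hcoeff : Function.Surjective coeff := by
    rintro ⟨y, hy⟩
    obtain ⟨x, hx, rfl⟩ := exists_mem_cechDegree_cechCoeff_eq y
    have hdx : cechD _ i x = 0 := by
      refine eq_zero_of_mem_cechDegree (cechD_mem_cechDegree hx) ?_
      rw [cechCoeff_cechD]
      exact hy
    exact ⟨⟨⟨x, hdx⟩, hx⟩, rfl⟩
  refine nonempty_linearEquiv_of_surjective_of_ker_eq (R := A) (M := N)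
    (P := localCohomologyDegree a ξ i u) classOf (W.mkQ ∘ₗ coeff)
    (LinearMap.submoduleMap_surjective _ N) ((Submodule.mkQ_surjective _).comp hcoeff) ?_
  ext z
  have hclass : z ∈ LinearMap.ker classOf ↔ z.1.1 ∈ cechCoboundaries (cMonomial a ξ) i := by
    rw [LinearMap.mem_ker, Subtype.ext_iff]
    exact Submodule.Quotient.mk_eq_zero Q
  have hcoeffClass : z ∈ LinearMap.ker (W.mkQ ∘ₗ coeff) ↔ cechCoeff a ξ u i z.1.1 ∈
      LinearMap.range (supportedD a (degreeSupport ξ u) (i - 1) i) := by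
    rw [LinearMap.mem_ker]
    exact Submodule.Quotient.mk_eq_zero W
  exact hclass.trans ((mem_cechCoboundaries_iff z.2).trans hcoeffClass.symm)

end Coefficients

section BaseChange

variable {A B : Type*} [CommRing A] [CommRing B] [Algebra A B] {c : ℕ}

/-- The map `A_α → B_{α'}` if `α'` is the image of `α`. -/
noncomputable def awayBaseChange {α : A} {α' : B} (h : algebraMap A B α = α') :
    Localization.Away α →ₐ[A] Localization.Away α' :=
  IsLocalization.liftAlgHom (M := Submonoid.powers α)
    (f := Algebra.ofId A (Localization.Away α')) (by
      rintro ⟨_, m, rfl⟩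
      rw [map_pow, Algebra.ofId_apply, IsScalarTower.algebraMap_apply A B, h]
      exact (IsLocalization.Away.algebraMap_isUnit α').pow m)

theorem isBaseChange_awayBaseChange {α : A} {α' : B} (h : algebraMap A B α = α') :
    IsBaseChange B (awayBaseChange h).toLinearMap := by
  let _ : Algebra (Localization.Away α) (Localization.Away α') :=
    (awayBaseChange h).toRingHom.toAlgebra
  have : IsScalarTower A (Localization.Away α) (Localization.Away α') :=
    IsScalarTower.of_algebraMap_eq fun x => ((awayBaseChange h).commutes x).symm
  have : IsLocalization (Algebra.algebraMapSubmonoid B (Submonoid.powers α))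
      (Localization.Away α') := by
    rw [Algebra.algebraMapSubmonoid_powers, h]
    infer_instance
  have := Algebra.isPushout_of_isLocalization (Submonoid.powers α) (Localization.Away α) B
    (Localization.Away α')
  exact Algebra.IsPushout.out (R := A) (S := B) (R' := Localization.Away α)
    (S' := Localization.Away α')

theorem awayBaseChange_awayMap {α β : A} {α' β' : B} (hα : algebraMap A B α = α')
    (hβ : algebraMap A B β = β') (h : α ∣ β) (h' : α' ∣ β') (x : Localization.Away α) :
    awayBaseChange hβ (awayMap h x) = awayMap h' (awayBaseChange hα x) := by
  have : (awayBaseChange hβ).comp (awayMap h) =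
      ((awayMap h').restrictScalars A).comp (awayBaseChange hα) :=
    IsLocalization.algHom_ext (Submonoid.powers α) (Subsingleton.elim _ _)
  exact DFunLike.congr_fun this x

variable (B)

/-- The map induced by `A → B` on supported Čech cochains. -/
noncomputable def supportedBaseChange (a : Fin c → A) (Δ : Set (Finset (Fin c))) (k : ℕ) :
    SupportedCochain a Δ k →ₗ[A] SupportedCochain (fun j => algebraMap A B (a j)) Δ k :=
  LinearMap.pi fun S => (awayBaseChange (map_prod (algebraMap A B) a S.1)).toLinearMap ∘ₗ
    LinearMap.proj S

theorem supportedBaseChange_apply (a : Fin c → A) (Δ : Set (Finset (Fin c))) (k : ℕ)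
    (x : SupportedCochain a Δ k) (S : {S : Finset (Fin c) // S ∈ Δ ∧ S.card = k}) :
    supportedBaseChange B a Δ k x S =
      awayBaseChange (map_prod (algebraMap A B) a S.1) (x S) := rfl

theorem isBaseChange_supportedBaseChange (a : Fin c → A) (Δ : Set (Finset (Fin c))) (k : ℕ) :
    IsBaseChange B (supportedBaseChange B a Δ k) :=
  IsBaseChange.pi _ fun _ => isBaseChange_awayBaseChange _

theorem supportedD_supportedBaseChange (a : Fin c → A) (Δ : Set (Finset (Fin c))) (k l : ℕ)
    (x : SupportedCochain a Δ k) :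
    supportedD _ Δ k l (supportedBaseChange B a Δ k x) =
      supportedBaseChange B a Δ l (supportedD a Δ k l x) := by
  classical
  ext S
  rw [supportedBaseChange_apply, supportedD_apply, supportedD_apply, map_sum]
  refine Finset.sum_congr rfl fun j _ => ?_
  split_ifs
  · rw [neg_one_pow_smul_eq A, map_smul,
      awayBaseChange_awayMap (map_prod (algebraMap A B) a _)]
    rfl
  · rw [map_zero]

theorem nonempty_supportedCohomology_baseChange_equiv [Module.Flat A B] (a : Fin c → A)
    (Δ : Set (Finset (Fin c))) (i : ℕ) :
    Nonempty ((B ⊗[A] SupportedCohomology a Δ i) ≃ₗ[B]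
      SupportedCohomology (fun j => algebraMap A B (a j)) Δ i) :=
  nonempty_linearHomology_baseChange_equiv (isBaseChange_supportedBaseChange B a Δ (i - 1))
    (isBaseChange_supportedBaseChange B a Δ i) (isBaseChange_supportedBaseChange B a Δ (i + 1))
    (supportedD_supportedBaseChange B a Δ (i - 1) i)
    (supportedD_supportedBaseChange B a Δ i (i + 1))

theorem nonempty_localCohomologyDegree_baseChange_equiv [Module.Flat A B] {n : ℕ} (a : Fin c → A)
    (ξ : Fin c → Fin n →₀ ℕ) (i : ℕ) (u : Fin n → ℤ) :
    Nonempty ((B ⊗[A] localCohomologyDegree a ξ i u) ≃ₗ[B]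
      localCohomologyDegree (fun j => algebraMap A B (a j)) ξ i u) := by
  obtain ⟨eA⟩ := nonempty_localCohomologyDegree_equiv a ξ u i
  obtain ⟨eAB⟩ := nonempty_supportedCohomology_baseChange_equiv B a (degreeSupport ξ u) i
  obtain ⟨eB⟩ := nonempty_localCohomologyDegree_equiv (fun j => algebraMap A B (a j)) ξ u i
  exact ⟨eA.baseChange A B _ _ ≪≫ₗ eAB ≪≫ₗ eB.symm⟩

end BaseChange

end SupportedCech

/-! ### Local cohomology over a discrete valuation ring -/

section DiscreteValuationRing

variable {B : Type*} (K : Type*) [CommRing B] [IsDomain B] [IsDiscreteValuationRing B] [Field K]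
  [Algebra B K] [IsFractionRing B K]

theorem exists_dvd_pow_of_not_isUnit {x y : B} (hx : ¬IsUnit x) (hy : y ≠ 0) :
    ∃ m : ℕ, y ∣ x ^ m := by
  obtain ⟨ϖ, hϖ⟩ := IsDiscreteValuationRing.exists_irreducible B
  obtain ⟨m, hm⟩ := IsDiscreteValuationRing.associated_pow_irreducible hy hϖ
  have hϖx : ϖ ∣ x := by
    rw [← Ideal.mem_span_singleton,
      ← (IsDiscreteValuationRing.irreducible_iff_uniformizer ϖ).1 hϖ]
    exact hx
  exact ⟨m, hm.dvd.trans (pow_dvd_pow_of_dvd hϖx m)⟩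

theorem isFractionRing_away_of_not_isUnit {α : B} (h0 : α ≠ 0) (hα : ¬IsUnit α) :
    IsFractionRing B (Localization.Away α) := by
  refine IsLocalization.isLocalization_of_is_exists_mul_mem _ (Submonoid.powers α) _
    (powers_le_nonZeroDivisors_of_noZeroDivisors h0) fun y => ?_
  obtain ⟨m, c, hc⟩ := exists_dvd_pow_of_not_isUnit hα (nonZeroDivisors.ne_zero y.2)
  exact ⟨c, m, hc.trans (mul_comm _ _)⟩

theorem isFiniteModVectorSpace_away (α : B) :
    IsFiniteModVectorSpace B K (Localization.Away α) := by
  by_cases hα : IsUnit α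
  · have : Module.Finite B (Localization.Away α) :=
      .equiv (IsLocalization.atUnit B (Localization.Away α) α hα).toLinearEquiv
    exact isFiniteModVectorSpace_of_finite_quotient K (0 : K →ₗ[B] _) inferInstance
  by_cases h0 : α = 0
  · have : Subsingleton (Localization.Away α) :=
      IsLocalization.subsingleton (M := Submonoid.powers α) (h0 ▸ Submonoid.mem_powers α)
    exact isFiniteModVectorSpace_of_finite_quotient K (0 : K →ₗ[B] _) inferInstance
  · have := isFractionRing_away_of_not_isUnit h0 hα
    let e : K ≃ₗ[B] Localization.Away α :=
      (IsLocalization.algEquiv (nonZeroDivisors B) K (Localization.Away α)).toLinearEquiv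
    have : Subsingleton (Localization.Away α ⧸ LinearMap.range e.toLinearMap) :=
      Submodule.Quotient.subsingleton_iff.2 e.range
    exact isFiniteModVectorSpace_of_finite_quotient K e.toLinearMap inferInstance

theorem hasTorsionSplitting_supportedCohomology {c : ℕ} (a : Fin c → B)
    (Δ : Set (Finset (Fin c))) (i : ℕ) : HasTorsionSplitting B K (SupportedCohomology a Δ i) :=
  hasTorsionSplitting_linearHomology
    (isFiniteModVectorSpace_pi K fun _ => isFiniteModVectorSpace_away K _)
    (isFiniteModVectorSpace_pi K fun _ => isFiniteModVectorSpace_away K _) _ _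

theorem hasTorsionSplitting_localCohomologyDegree {n c : ℕ} (a : Fin c → B)
    (ξ : Fin c → Fin n →₀ ℕ) (i : ℕ) (u : Fin n → ℤ) :
    HasTorsionSplitting B K (localCohomologyDegree a ξ i u) := by
  obtain ⟨e⟩ := nonempty_localCohomologyDegree_equiv a ξ u i
  exact (hasTorsionSplitting_supportedCohomology K a (degreeSupport ξ u) i).of_equiv e

theorem hasTorsionSplitting_baseChange_localCohomologyDegree {A : Type*} [CommRing A] [Algebra A B]
    [Module.Flat A B] {n c : ℕ} (a : Fin c → A) (ξ : Fin c → Fin n →₀ ℕ) (i : ℕ) (u : Fin n → ℤ) :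
    HasTorsionSplitting B K (B ⊗[A] localCohomologyDegree a ξ i u) := by
  obtain ⟨e⟩ := nonempty_localCohomologyDegree_baseChange_equiv B a ξ i u
  exact (hasTorsionSplitting_localCohomologyDegree K _ ξ i u).of_equiv e

end DiscreteValuationRing

/-! ### Local cohomology over a Dedekind domain -/

section DedekindDomain

theorem exists_gammaTorsion_equiv_injectiveHull {A B K : Type v} [CommRing A] [CommRing B]
    [Algebra A B] {p : Ideal A} [p.IsMaximal] [IsLocalization.AtPrime B p] [IsDomain B]
    [IsDiscreteValuationRing B] [Field K] [Algebra B K] [IsFractionRing B K] [Algebra A K]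
    [IsScalarTower A B K] (hp : p.FG) {M : Type*} [AddCommGroup M] [Module A M]
    (h : HasTorsionSplitting B K (B ⊗[A] M)) :
    ∃ (l t : ℕ) (β : Fin t → ℕ), Nonempty (gammaTorsion p M ≃ₗ[A]
      (Fin l → InjectiveHull A (A ⧸ p)) × ∀ j : Fin t, A ⧸ p ^ β j) := by
  obtain ⟨eM⟩ := nonempty_gammaTorsion_equiv_of_isLocalizedModule p hp (TensorProduct.mk A B M 1)
  have hΓ : gammaTorsion p (B ⊗[A] M) =
      (gammaTorsion (IsLocalRing.maximalIdeal B) (B ⊗[A] M)).restrictScalars A := by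
    rw [← IsLocalization.AtPrime.map_eq_maximalIdeal p B, restrictScalars_gammaTorsion_map]
  obtain ⟨l, t, β, ⟨eB⟩⟩ := h.gammaTorsion_equiv
  obtain ⟨eE⟩ := nonempty_fractionQuotient_equiv_injectiveHull (B := B) (K := K) p
  exact ⟨l, t, β, ⟨eM ≪≫ₗ .ofEq _ _ hΓ ≪≫ₗ eB.restrictScalars A ≪≫ₗ
    (LinearEquiv.piCongrRight fun _ => eE).prodCongr (.piCongrRight fun j =>
      (IsLocalization.AtPrime.equivQuotMaximalIdealPow p B (β j)).symm.toLinearEquiv)⟩⟩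

theorem map_completedLocalization_eq_maximalIdeal {A : Type*} [CommRing A] [IsNoetherianRing A]
    (q : Ideal A) [q.IsPrime] : q.map (algebraMap A (CompletedLocalization q)) =
      IsLocalRing.maximalIdeal (CompletedLocalization q) := by
  rw [IsScalarTower.algebraMap_eq A (Localization.AtPrime q) (CompletedLocalization q),
    ← Ideal.map_map, IsLocalization.AtPrime.map_eq_maximalIdeal q (Localization.AtPrime q),
    AdicCompletion.maximalIdeal_eq_map]

theorem flat_completedLocalization {A : Type*} [CommRing A] [IsNoetherianRing A]
    (q : Ideal A) [q.IsPrime] : Module.Flat A (CompletedLocalization q) :=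
  Module.Flat.trans A (Localization.AtPrime q) (CompletedLocalization q)

theorem theorem2p6_general {A : Type*} [CommRing A] [IsDedekindDomain A] {n c : ℕ}
    (a : Fin c → A) (ξ : Fin c → Fin n →₀ ℕ) (i : ℕ) (u : Fin n → ℤ) (p : Ideal A) [p.IsPrime]
    (hp : p ≠ ⊥) :
    (∃ (l t : ℕ) (β : Fin t → ℕ), Nonempty
      (gammaTorsion p (localCohomologyDegree a ξ i u) ≃ₗ[A]
        (Fin l → InjectiveHull A (A ⧸ p)) × (∀ j : Fin t, A ⧸ p ^ β j))) ∧
    Nonempty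
      ((CompletedLocalization p ⊗[A] localCohomologyDegree a ξ i u) ≃ₗ[CompletedLocalization p]
        localCohomologyDegree (fun j => algebraMap A (CompletedLocalization p) (a j)) ξ i u) ∧
    ∃ r s : ℕ, Nonempty
      (((CompletedLocalization p ⊗[A] localCohomologyDegree a ξ i u) ⧸
          gammaTorsion (p.map (algebraMap A (CompletedLocalization p)))
            (CompletedLocalization p ⊗[A] localCohomologyDegree a ξ i u))
        ≃ₗ[CompletedLocalization p]
        (Fin r → CompletedLocalization p) × (Fin s → FractionRing (CompletedLocalization p))) := by
  have : p.IsMaximal := ‹p.IsPrime›.isMaximal hp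
  have : IsDiscreteValuationRing (Localization.AtPrime p) :=
    IsLocalization.AtPrime.isDiscreteValuationRing_of_dedekind_domain A hp _
  have := flat_completedLocalization p
  refine ⟨exists_gammaTorsion_equiv_injectiveHull (B := Localization.AtPrime p)
      (IsNoetherian.noetherian p)
      (hasTorsionSplitting_baseChange_localCohomologyDegree (FractionRing A) a ξ i u),
    nonempty_localCohomologyDegree_baseChange_equiv _ a ξ i u, ?_⟩
  rw [map_completedLocalization_eq_maximalIdeal]
  exact (hasTorsionSplitting_baseChange_localCohomologyDegree
    (FractionRing (CompletedLocalization p)) a ξ i u).quotient_gammaTorsion_equiv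

end DedekindDomain

theorem theorem2p6 {A : Type*} [CommRing A] [IsDedekindDomain A]
    (hA : ∀ (p : Ideal A) [p.IsPrime], p ≠ ⊥ →
      IsMixedChar (Localization.AtPrime p) ∧
        Finite (IsLocalRing.ResidueField (Localization.AtPrime p)))
    {n c : ℕ} (a : Fin c → A) (ξ : Fin c → Fin n →₀ ℕ)
    (i : ℕ) (u : Fin n → ℤ) :
    (∀ p ∈ associatedPrimes A (LocalCohomologyModule (cMonomial a ξ) i), p ≠ ⊥ →
      ∃ (l t : ℕ) (β : Fin t → ℕ), Nonempty
        (gammaTorsion p (localCohomologyDegree a ξ i u) ≃ₗ[A]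
          (Fin l → InjectiveHull A (A ⧸ p)) × (∀ j : Fin t, A ⧸ p ^ β j))) ∧
    (∀ (q : Ideal A) [q.IsPrime], q ≠ ⊥ →
      Nonempty
        ((CompletedLocalization q ⊗[A] localCohomologyDegree a ξ i u) ≃ₗ[CompletedLocalization q]
          localCohomologyDegree (fun j => algebraMap A (CompletedLocalization q) (a j)) ξ i u) ∧
      ∃ r s : ℕ, Nonempty
        (((CompletedLocalization q ⊗[A] localCohomologyDegree a ξ i u) ⧸
            gammaTorsion (q.map (algebraMap A (CompletedLocalization q)))
              (CompletedLocalization q ⊗[A] localCohomologyDegree a ξ i u))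
          ≃ₗ[CompletedLocalization q]
          (Fin r → CompletedLocalization q) ×
            (Fin s → FractionRing (CompletedLocalization q)))) := by
  refine ⟨fun p hp hp0 => ?_, fun q _ hq => (theorem2p6_general a ξ i u q hq).2⟩
  have := hp.isPrime
  exact (theorem2p6_general a ξ i u p hp0).1
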